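/- Let $\mathbb{H}_2$ be the Siegel upper half space of degree $2$, with variable $Z=\begin{pmatrix}\tau & z\\ z&\tau'\end{pmatrix}=X+iY$, let $\Gamma=\mathrm{Sp}_2(\mathbb{Z})$ be the group of integral symplectic $4\times4$ matrices $M=\begin{pmatrix}A&B\\C&D\end{pmatrix}$, acting by $M\circ Z=(AZ+B)(CZ+D)^{-1}$, and let $\Gamma_\infty=\{M\in\Gamma : C=0\}$. For $\alpha,\beta\in\mathbb{C}$ with $\alpha-\beta\in\mathbb{Z}$ and $G:\mathbb{H}_2\to\mathbb{C}$ put $$(G|_{(\alpha,\beta)}M)(Z)=\det(CZ+D)^{-\alpha}\det(C\overline Z+D)^{-\beta}\,G(M\circ Z),$$ where complex conjugate logarithms are used in the two powers. For an odd integer $k$ and $s\in\mathbb{C}$ let $$P_{k,s}(Z)=\sum_{M\in\Gamma_\infty\backslash\Gamma}\left((\det Y)^s|_{(\frac12,\,k-\frac12)}M\right)(Z),$$ for even $\kappa$ let $E_\kappa(Z)=\sum_{M\in\Gamma_\infty\backslash\Gamma}\det(CZ+D)^{-\kappa}$ be the holomorphic Siegel Eisenstein series of weight $\kappa$, and let $\xi^{(2)}_{\frac12,k-\frac12}=(\det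 Y)^{k-\frac32}M_{\frac12}$, where $$M_\alpha=\alpha(\alpha-\tfrac12)+(\alpha-\tfrac12)\bigl((\tau-\overline\tau)\partial_\tau+(z-\overline z)\partial_z+(\tau'-\overline{\tau'})\partial_{\tau'}\bigr)+\det(Z-\overline Z)\bigl(\partial_\tau\partial_{\tau'}-\tfrac14\partial_z^2\bigr)$$ is Maass' raising operator, with Wirtinger derivatives $\partial_w=\frac12(\partial_a-i\partial_b)$ for $w=a+ib$. Let $k$ be an odd integer. (1) If $k>3$, then the series $P_{k,0}$ converges absolutely on $\mathbb{H}_2$ to a twice continuously differentiable function, and $\xi^{(2)}_{\frac12,k-\frac12}(P_{k,0})=0$ on $\mathbb{H}_2$. (2) If $k<0$, then the series $P_{k,\frac32-k}$ and $E_{3-k}$ converge absolutely on $\mathbb{H}_2$, $P_{k,\frac32-k}$ is twice continuously differentiable there, and on $\mathbb{H}_2$ $$\xi^{(2)}_{\frac12,k-\frac12}\bigl(P_{k,\frac32-k}\bigr)=\left(k-\tfrac32\right)(k-2)\,E_{3-k}.$$ -/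

import Mathlib

open scoped ComplexConjugate Matrix

namespace SiegelMaass

noncomputable section

/-- Complex `2 × 2` matrices. Functions on the Siegel upper half space are represented by functions
on all of `Mat2`; only their values on `siegelH2` matter. -/
abbrev Mat2 : Type := Matrix (Fin 2) (Fin 2) ℂ

/-- The Siegel upper half space of degree two: symmetric `Z = X + iY` with `Y` positive definite. -/
def siegelH2 : Set Mat2 := {Z | Z.IsSymm ∧ (Z.map Complex.im).PosDef}

/-- The symmetric matrix `Z` with coordinates `(τ, z, τ')`. -/
def ofCoords (p : ℂ × ℂ × ℂ) : Mat2 := !![p.1, p.2.1; p.2.1, p.2.2]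

/-- `det Y` for `Z = X + iY`. -/
def detIm (Z : Mat2) : ℝ := (Z.map Complex.im).det

/-! ### Differential operators -/

/-- The coordinate directions of `τ`, `z` and `τ'` in the space of symmetric matrices. -/
def dirTau : Mat2 := !![1, 0; 0, 0]

/-- See `dirTau`. -/
def dirZ : Mat2 := !![0, 1; 1, 0]

/-- See `dirTau`. -/
def dirTau' : Mat2 := !![0, 0; 0, 1]

/-- The Wirtinger derivative `∂/∂w = (∂/∂a - i ∂/∂b) / 2` for the complex coordinate `w = a + ib`
whose coordinate direction is `v`. -/
def wirtinger (v : Mat2) (G : Mat2 → ℂ) (Z : Mat2) : ℂ :=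
  (1 / 2) * (lineDeriv ℝ G Z v - Complex.I * lineDeriv ℝ G Z (Complex.I • v))

/-- Maass' raising operator
`M_α = α(α - 1/2) + (α - 1/2) ((τ - τ̄)∂_τ + (z - z̄)∂_z + (τ' - τ̄')∂_τ')
  + det(Z - Z̄) (∂_τ ∂_τ' - ∂_z² / 4)`. -/
def maassRaising (α : ℂ) (G : Mat2 → ℂ) (Z : Mat2) : ℂ :=
  α * (α - 1 / 2) * G Z
    + (α - 1 / 2) *
      ((Z 0 0 - conj (Z 0 0)) * wirtinger dirTau G Z
        + (Z 0 1 - conj (Z 0 1)) * wirtinger dirZ G Z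
        + (Z 1 1 - conj (Z 1 1)) * wirtinger dirTau' G Z)
    + (Z - Z.map conj).det *
      (wirtinger dirTau (wirtinger dirTau' G) Z
        - (1 / 4) * wirtinger dirZ (wirtinger dirZ G) Z)

/-- The operator `ξ^{(2)}_{1/2, k-1/2} = det(Y)^{k - 3/2} M_{1/2}`. -/
def xiOp (k : ℤ) (G : Mat2 → ℂ) (Z : Mat2) : ℂ :=
  ((detIm Z ^ ((k : ℝ) - 3 / 2) : ℝ) : ℂ) * maassRaising (1 / 2) G Z

/-! ### The modular group and its action -/

/-- `Γ = Sp₂(ℤ)`, the group of integral symplectic `4 × 4` matrices. -/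
abbrev Γ₂ : Type := Matrix.symplecticGroup (Fin 2) ℤ

/-- The blocks of `M = (A B; C D)`, with complex entries. -/
def blockA (M : Γ₂) : Mat2 := M.1.toBlocks₁₁.map (Int.cast : ℤ → ℂ)

/-- See `blockA`. -/
def blockB (M : Γ₂) : Mat2 := M.1.toBlocks₁₂.map (Int.cast : ℤ → ℂ)

/-- See `blockA`. -/
def blockC (M : Γ₂) : Mat2 := M.1.toBlocks₂₁.map (Int.cast : ℤ → ℂ)

/-- See `blockA`. -/
def blockD (M : Γ₂) : Mat2 := M.1.toBlocks₂₂.map (Int.cast : ℤ → ℂ)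

/-- `det(CZ + D)`. -/
def detJ (M : Γ₂) (Z : Mat2) : ℂ := (blockC M * Z + blockD M).det

/-- `M ∘ Z = (AZ + B)(CZ + D)⁻¹`. -/
def act (M : Γ₂) (Z : Mat2) : Mat2 :=
  (blockA M * Z + blockB M) * (blockC M * Z + blockD M)⁻¹

/-- `w^{-α} w̄^{-β}` for `w ≠ 0` and `α - β ∈ ℤ`, where the logarithms used for `w` and for `w̄` are
conjugate to each other, so that the value does not depend on the branch. -/
def powPair (α β w : ℂ) : ℂ :=
  Complex.exp (-(α * Complex.log w) - β * conj (Complex.log w))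

/-- The slash operator
`(G |_{(α,β)} M)(Z) = det(CZ + D)^{-α} det(CZ̄ + D)^{-β} G(M ∘ Z)`, for `α - β ∈ ℤ`. -/
def slash (α β : ℂ) (G : Mat2 → ℂ) (M : Γ₂) (Z : Mat2) : ℂ :=
  powPair α β (detJ M Z) * G (act M Z)

/-- `Γ_∞`, the subgroup of `Γ` given by `C = 0`. -/
def ΓInf : Subgroup Γ₂ where
  carrier := {M | M.1.toBlocks₂₁ = 0}
  one_mem' := by
    ext i j
    simp [Matrix.toBlocks₂₁]
  mul_mem' := by
    intro M N hM hN
    have hM' : M.1.toBlocks₂₁ = 0 := hM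
    have hN' : N.1.toBlocks₂₁ = 0 := hN
    change (M.1 * N.1).toBlocks₂₁ = 0
    rw [← Matrix.fromBlocks_toBlocks M.1, ← Matrix.fromBlocks_toBlocks N.1,
      Matrix.fromBlocks_multiply, hM', hN']
    simp
  inv_mem' := by
    intro M hM
    have hM' : M.1.toBlocks₂₁ = 0 := hM
    change (-Matrix.J (Fin 2) ℤ * M.1ᵀ * Matrix.J (Fin 2) ℤ).toBlocks₂₁ = 0
    rw [← Matrix.fromBlocks_toBlocks M.1, hM', Matrix.fromBlocks_transpose, Matrix.J,
      Matrix.fromBlocks_neg, Matrix.fromBlocks_multiply, Matrix.fromBlocks_multiply]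
    simp

/-- The set of cosets `Γ_∞ \ Γ`. -/
abbrev CosetSpace : Type := Quotient (QuotientGroup.rightRel ΓInf)

/-! ### The two series -/

/-- The summand `((det Y)^s |_{(1/2, k-1/2)} M)(Z)`. -/
def poincareTerm (k : ℤ) (s : ℂ) (M : Γ₂) (Z : Mat2) : ℂ :=
  slash (1 / 2) ((k : ℂ) - 1 / 2) (fun W => ((detIm W : ℝ) : ℂ) ^ s) M Z

/-- The Poincaré-Eisenstein series `P_{k,s}`. For odd `k` the summand depends only on the coset of
`M`, see `poincareTerm_eq_of_rightRel`. -/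
def poincareEisenstein (k : ℤ) (s : ℂ) (Z : Mat2) : ℂ :=
  ∑' q : CosetSpace, poincareTerm k s q.out Z

/-- The holomorphic Siegel Eisenstein series
`E_κ(Z) = ∑_{M ∈ Γ_∞ \ Γ} det(CZ + D)^{-κ}` of weight `κ`. For even `κ` the summand depends only on
the coset of `M`, see `detJ_zpow_eq_of_rightRel`. -/
def siegelEisenstein (κ : ℤ) (Z : Mat2) : ℂ :=
  ∑' q : CosetSpace, detJ q.out Z ^ (-κ)

/-! ### The summands are well defined on cosets -/

theorem blocks_mul (M N : Γ₂) :
    blockA (M * N) = blockA M * blockA N + blockB M * blockC N ∧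
    blockB (M * N) = blockA M * blockB N + blockB M * blockD N ∧
    blockC (M * N) = blockC M * blockA N + blockD M * blockC N ∧
    blockD (M * N) = blockC M * blockB N + blockD M * blockD N := by
  refine ⟨?_, ?_, ?_, ?_⟩ <;>
  · ext i j
    simp [blockA, blockB, blockC, blockD, Matrix.mul_apply, Matrix.toBlocks₁₁, Matrix.toBlocks₁₂,
      Matrix.toBlocks₂₁, Matrix.toBlocks₂₂]

theorem blockC_of_mem {g : Γ₂} (hg : g ∈ ΓInf) : blockC g = 0 := by
  have h : g.1.toBlocks₂₁ = 0 := hg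
  ext i j
  simp [blockC, h]

theorem integral_blocks_of_mem {g : Γ₂} (hg : g ∈ ΓInf) :
    g.1.toBlocks₁₁ * g.1.toBlocks₂₂ᵀ = 1 := by
  have h : g.1.toBlocks₂₁ = 0 := hg
  have hs := (SymplecticGroup.mem_iff (A := g.1)).1 g.2
  rw [← Matrix.fromBlocks_toBlocks g.1, h, Matrix.J, Matrix.fromBlocks_transpose,
    Matrix.fromBlocks_multiply, Matrix.fromBlocks_multiply] at hs
  have := (Matrix.fromBlocks_inj.1 hs).2.1
  simpa using this

theorem blockA_mul_transpose_blockD {g : Γ₂} (hg : g ∈ ΓInf) :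
    blockA g * (blockD g)ᵀ = 1 := by
  have h := congrArg (fun N : Matrix (Fin 2) (Fin 2) ℤ => N.map (Int.castRingHom ℂ))
    (integral_blocks_of_mem hg)
  simp only [Matrix.map_mul] at h
  rw [Matrix.map_one _ (map_zero _) (map_one _)] at h
  exact h

theorem det_blockD_of_mem {g : Γ₂} (hg : g ∈ ΓInf) :
    (blockD g).det = 1 ∨ (blockD g).det = -1 := by
  have h : g.1.toBlocks₁₁.det * g.1.toBlocks₂₂.det = 1 := by
    rw [← Matrix.det_transpose g.1.toBlocks₂₂, ← Matrix.det_mul, integral_blocks_of_mem hg,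
      Matrix.det_one]
  have hc : (blockD g).det = ((g.1.toBlocks₂₂.det : ℤ) : ℂ) :=
    ((Int.castRingHom ℂ).map_det g.1.toBlocks₂₂).symm
  rcases Int.isUnit_iff.1 (IsUnit.of_mul_eq_one_right _ h) with h1 | h1 <;> simp [hc, h1]

theorem detJ_mul_of_mem {g : Γ₂} (hg : g ∈ ΓInf) (M : Γ₂) (Z : Mat2) :
    detJ (g * M) Z = (blockD g).det * detJ M Z := by
  obtain ⟨-, -, h3, h4⟩ := blocks_mul g M
  rw [detJ, detJ, h3, h4, blockC_of_mem hg, ← Matrix.det_mul]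
  congr 1
  noncomm_ring

theorem powPair_eq (α : ℂ) (n : ℤ) {w : ℂ} (hw : w ≠ 0) :
    powPair α (α + n) w = ((‖w‖ : ℝ) : ℂ) ^ (-(2 * α)) * conj w ^ (-n) := by
  have hn : ((‖w‖ : ℝ) : ℂ) ≠ 0 := by simpa using hw
  have h1 : conj w = Complex.exp (conj (Complex.log w)) := by
    rw [Complex.exp_conj, Complex.exp_log hw]
  have h2 : Complex.log w + conj (Complex.log w) = 2 * Complex.log ((‖w‖ : ℝ) : ℂ) := by
    rw [Complex.add_conj, Complex.log_re, ← Complex.ofReal_log (norm_nonneg w)]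
    push_cast
    ring
  rw [h1, ← Complex.exp_int_mul, Complex.cpow_def_of_ne_zero hn, ← Complex.exp_add, powPair]
  congr 1
  push_cast
  linear_combination (-α) * h2

theorem powPair_neg {k : ℤ} (hk : Odd k) (w : ℂ) :
    powPair (1 / 2) ((k : ℂ) - 1 / 2) (-w) = powPair (1 / 2) ((k : ℂ) - 1 / 2) w := by
  by_cases hw : w = 0
  · simp [hw]
  have hb : (k : ℂ) - 1 / 2 = 1 / 2 + ((k - 1 : ℤ) : ℂ) := by
    push_cast
    ring
  have he : Even (-(k - 1)) := by
    obtain ⟨m, rfl⟩ := hk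
    exact ⟨-m, by ring⟩
  rw [hb, powPair_eq _ _ hw, powPair_eq _ _ (neg_ne_zero.2 hw), norm_neg, map_neg, he.neg_zpow]

theorem detIm_act_mul_of_mem {g : Γ₂} (hg : g ∈ ΓInf) (M : Γ₂) (Z : Mat2) :
    detIm (act (g * M) Z) = detIm (act M Z) := by
  obtain ⟨h1, h2, h3, h4⟩ := blocks_mul g M
  have hAD := blockA_mul_transpose_blockD hg
  have hDA : blockD g * (blockA g)ᵀ = 1 := by
    have := congrArg Matrix.transpose hAD
    simpa using this
  have hDinv : (blockD g)⁻¹ = (blockA g)ᵀ := Matrix.inv_eq_right_inv hDA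
  have hden : blockC (g * M) * Z + blockD (g * M) = blockD g * (blockC M * Z + blockD M) := by
    rw [h3, h4, blockC_of_mem hg]
    noncomm_ring
  have hnum : blockA (g * M) * Z + blockB (g * M)
      = blockA g * (blockA M * Z + blockB M) + blockB g * (blockC M * Z + blockD M) := by
    rw [h1, h2]
    noncomm_ring
  have hact : act (g * M) Z = blockA g * act M Z * (blockA g)ᵀ
      + blockB g * ((blockC M * Z + blockD M) * (blockC M * Z + blockD M)⁻¹) * (blockA g)ᵀ := by
    rw [act, act, hden, hnum, Matrix.mul_inv_rev, hDinv]
    noncomm_ring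
  obtain ⟨e, he⟩ : ∃ e : ℤ,
      (blockC M * Z + blockD M) * (blockC M * Z + blockD M)⁻¹ = (e : ℂ) • (1 : Mat2) := by
    by_cases hu : IsUnit (blockC M * Z + blockD M).det
    · exact ⟨1, by rw [Matrix.mul_nonsing_inv _ hu]; simp⟩
    · exact ⟨0, by rw [Matrix.nonsing_inv_apply_not_isUnit _ hu]; simp⟩
  have him : (act (g * M) Z).map Complex.im
      = g.1.toBlocks₁₁.map (Int.cast : ℤ → ℝ) * (act M Z).map Complex.im
        * (g.1.toBlocks₁₁.map (Int.cast : ℤ → ℝ))ᵀ := by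
    rw [hact, he]
    ext i j
    simp [Matrix.mul_apply, Fin.sum_univ_two, blockA, blockB, Complex.add_im, Complex.mul_im]
  have hdet : (g.1.toBlocks₁₁.map (Int.cast : ℤ → ℝ)).det
      * (g.1.toBlocks₁₁.map (Int.cast : ℤ → ℝ)).det = 1 := by
    have h : g.1.toBlocks₁₁.det * g.1.toBlocks₂₂.det = 1 := by
      rw [← Matrix.det_transpose g.1.toBlocks₂₂, ← Matrix.det_mul, integral_blocks_of_mem hg,
        Matrix.det_one]
    have hc : (g.1.toBlocks₁₁.map (Int.cast : ℤ → ℝ)).det = ((g.1.toBlocks₁₁.det : ℤ) : ℝ) :=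
      ((Int.castRingHom ℝ).map_det g.1.toBlocks₁₁).symm
    rcases Int.isUnit_iff.1 (IsUnit.of_mul_eq_one _ h) with h5 | h5 <;> simp [hc, h5]
  rw [detIm, him, Matrix.det_mul, Matrix.det_mul, Matrix.det_transpose, detIm]
  linear_combination ((act M Z).map Complex.im).det * hdet

theorem poincareTerm_eq_of_rightRel {k : ℤ} (hk : Odd k) (s : ℂ) {M N : Γ₂}
    (h : QuotientGroup.rightRel ΓInf M N) (Z : Mat2) :
    poincareTerm k s M Z = poincareTerm k s N Z := by
  have hg : N * M⁻¹ ∈ ΓInf := QuotientGroup.rightRel_apply.1 h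
  have hN : N = N * M⁻¹ * M := by group
  rw [hN]
  generalize N * M⁻¹ = g at hg
  rw [poincareTerm, poincareTerm, slash, slash, detIm_act_mul_of_mem hg, detJ_mul_of_mem hg]
  rcases det_blockD_of_mem hg with h1 | h1 <;> rw [h1]
  · rw [one_mul]
  · rw [neg_one_mul, powPair_neg hk]

theorem detJ_zpow_eq_of_rightRel {κ : ℤ} (hκ : Even κ) {M N : Γ₂}
    (h : QuotientGroup.rightRel ΓInf M N) (Z : Mat2) :
    detJ M Z ^ (-κ) = detJ N Z ^ (-κ) := by
  have hg : N * M⁻¹ ∈ ΓInf := QuotientGroup.rightRel_apply.1 h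
  have hN : N = N * M⁻¹ * M := by group
  rw [hN]
  generalize N * M⁻¹ = g at hg
  rw [detJ_mul_of_mem hg]
  rcases det_blockD_of_mem hg with h1 | h1 <;> rw [h1]
  · rw [one_mul]
  · rw [neg_one_mul, hκ.neg.neg_zpow]

end

end SiegelMaass

open SiegelMaass

namespace SiegelMaass

noncomputable section

/-! ### A divisor bound -/

/-! The lower half (C D) of M matters only through its five independent 2×2 minors v. They form a
nonzero integral vector on the quadric v₂² = v₁v₃ - v₀v₄, and they determine the coset of M
(`minors_out_injective`). On symmetric Z, J = det(CZ + D) is the polynomial `quadJ v` in (τ, z, τ').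
Together with `detIm_act` this turns the summand of P_{k,s}, for real s, into `isoTerm s k v`
(`poincareTerm_ofCoords`).

Convergence. `isoTerm` is homogeneous of degree -(2s+k) in v, and J has no zero on the half space
when v is a nonzero real point of the quadric. Compactness of the unit sphere of the quadric
therefore bounds the term and its first two derivatives, locally uniformly, by C‖v‖^{-(2s+k)}
(`exists_isoTerm_bound`). The sum of ‖v‖^{-4} over integral points converges: v₀, v₂, v₄ fix the
product v₁v₃, so where it is nonzero the remaining freedom is a divisor and a sign. Since d(n) ≤ 16
n^{1/3}, this costs 2/3 in the exponent, and 4 - 2/3 > 3. In both parts of the theorem 2s + k ≥ 4,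
so all derivatives may be taken termwise.

The identity. At α = 1/2 Maass' operator reduces to -4 det Y (∂_τ∂_τ' - ∂_z²/4). It multiplies each
term by s(s + 1/2) conj(J)/J (`coordLaplace_isoTerm`). This vanishes for s = 0. For s = 3/2 - k the
scalar is (k - 3/2)(k - 2), and after multiplication by (det Y)^{k-3/2} only J^{k-3} is left
(`poincareTerm_mul_conj_div`). -/

theorem succ_le_two_pow (a : ℕ) : a + 1 ≤ 2 ^ a := Nat.lt_two_pow_self

theorem succ_pow_three_le (a : ℕ) : (a + 1) ^ 3 ≤ 8 * 2 ^ a := by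
  rcases Nat.lt_or_ge a 4 with h | h
  · interval_cases a <;> norm_num
  · induction a, h using Nat.le_induction with
    | base => norm_num
    | succ n hn ih =>
      have h1 : (n + 1 + 1) ^ 3 ≤ 2 * (n + 1) ^ 3 := by
        obtain ⟨m, rfl⟩ := Nat.exists_eq_add_of_le hn
        nlinarith [Nat.zero_le m, Nat.zero_le (m ^ 2), Nat.zero_le (m ^ 3)]
      calc (n + 1 + 1) ^ 3 ≤ 2 * (n + 1) ^ 3 := h1
        _ ≤ 2 * (8 * 2 ^ n) := by gcongr
        _ = 8 * 2 ^ (n + 1) := by ring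

/-- By multiplicativity only prime powers matter. There (a+1)³ ≤ 8^a ≤ p^a if p ≥ 8, and a smaller
prime costs one factor 8. Only 2, 3, 5, 7 are smaller, hence the later constant 8⁴ = 16³. -/
theorem card_divisors_pow_three_le_aux (n : ℕ) (hn : n ≠ 0) :
    n.divisors.card ^ 3 ≤ 8 ^ (n.primeFactors.filter (· < 8)).card * n := by
  induction n using Nat.recOnPosPrimePosCoprime with
  | zero => exact absurd rfl hn
  | one => simp
  | prime_pow p a hp ha =>
    rw [Nat.divisors_prime_pow hp, Finset.card_map, Finset.card_range,
      Nat.primeFactors_prime_pow ha.ne' hp]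
    by_cases h8 : p < 8
    · rw [Finset.filter_singleton, if_pos h8, Finset.card_singleton, pow_one]
      calc (a + 1) ^ 3 ≤ 8 * 2 ^ a := succ_pow_three_le a
        _ ≤ 8 * p ^ a := by gcongr; exact hp.two_le
    · rw [Finset.filter_singleton, if_neg h8, Finset.card_empty, pow_zero, one_mul]
      calc (a + 1) ^ 3 ≤ (2 ^ a) ^ 3 := by gcongr; exact succ_le_two_pow a
        _ = 8 ^ a := by rw [← pow_mul, mul_comm, pow_mul]; norm_num
        _ ≤ p ^ a := by gcongr; omega
  | coprime a b ha hb hab iha ihb =>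
    have iha := iha (by omega)
    have ihb := ihb (by omega)
    rw [hab.card_divisors_mul, hab.primeFactors_mul, Finset.filter_union,
      Finset.card_union_of_disjoint
        (Finset.disjoint_filter_filter hab.disjoint_primeFactors), pow_add, mul_pow]
    calc _ ≤ _ := Nat.mul_le_mul iha ihb
      _ = _ := by ring

theorem card_divisors_pow_three_le (n : ℕ) : n.divisors.card ^ 3 ≤ 4096 * n := by
  rcases eq_or_ne n 0 with rfl | hn
  · simp
  refine (card_divisors_pow_three_le_aux n hn).trans ?_
  have hsub : n.primeFactors.filter (· < 8) ⊆ {2, 3, 5, 7} := by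
    intro p hp
    rw [Finset.mem_filter] at hp
    have h1 := (Nat.prime_of_mem_primeFactors hp.1)
    have h2 := hp.2
    interval_cases p <;> first | (simp; done) | exact absurd h1 (by norm_num)
  have hcard : (n.primeFactors.filter (· < 8)).card ≤ 4 :=
    (Finset.card_le_card hsub).trans (by decide)
  calc 8 ^ (n.primeFactors.filter (· < 8)).card * n ≤ 8 ^ 4 * n := by gcongr; norm_num
    _ = 4096 * n := by norm_num

theorem card_divisors_le_rpow (n : ℕ) :
    (n.divisors.card : ℝ) ≤ 16 * (n : ℝ) ^ (1 / 3 : ℝ) := by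
  have h : ((n.divisors.card : ℝ)) ^ 3 ≤ 4096 * (n : ℝ) := by
    exact_mod_cast card_divisors_pow_three_le n
  have h2 : (16 * (n : ℝ) ^ (1 / 3 : ℝ)) ^ 3 = 4096 * (n : ℝ) := by
    rw [mul_pow, ← Real.rpow_natCast ((n : ℝ) ^ (1 / 3 : ℝ)), ← Real.rpow_mul (by positivity)]
    norm_num
  rw [← h2] at h
  exact le_of_pow_le_pow_left₀ (by norm_num) (by positivity) h

/-! ### Sums over integral vectors -/

/-- `max 1 |x|` for an integer `x`, as a real number. -/
def intHeight (x : ℤ) : ℝ := max 1 |(x : ℝ)|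

theorem one_le_intHeight (x : ℤ) : 1 ≤ intHeight x := le_max_left _ _

theorem intHeight_pos (x : ℤ) : 0 < intHeight x := one_pos.trans_le (one_le_intHeight x)

theorem summable_intHeight_rpow {t : ℝ} (ht : 1 < t) :
    Summable fun x : ℤ => intHeight x ^ (-t) := by
  have h : Summable fun n : ℕ => max 1 (n : ℝ) ^ (-t) := by
    rw [← summable_nat_add_iff 1]
    have h1 := (summable_nat_add_iff 1).2 (Real.summable_nat_rpow.2 (by linarith : -t < -1))
    refine h1.congr fun n => ?_
    rw [max_eq_right]
    push_cast
    linarith [(Nat.cast_nonneg n : (0 : ℝ) ≤ n)]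
  refine Summable.of_nat_of_neg ?_ ?_ <;> simpa [intHeight] using h

theorem summable_intHeight_prod {r : ℝ} (hr : 3 < r) :
    Summable fun x : ℤ × ℤ × ℤ =>
      intHeight x.1 ^ (-(r / 3)) * (intHeight x.2.1 ^ (-(r / 3)) * intHeight x.2.2 ^ (-(r / 3))) := by
  have h := summable_intHeight_rpow (by linarith : 1 < r / 3)
  have h0 : ∀ x, 0 ≤ intHeight x ^ (-(r / 3)) := fun x => Real.rpow_nonneg (intHeight_pos x).le _
  exact h.mul_of_nonneg (h.mul_of_nonneg h h0 h0) h0 (fun x => mul_nonneg (h0 _) (h0 _))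

/-- Splitting the power into three equal factors replaces a sum over triples by a product of three
sums over ℤ, convergent once r/3 > 1. -/
theorem rpow_neg_le_intHeight_prod {r m : ℝ} (hr : 0 < r) {x y z : ℤ} (hx : intHeight x ≤ m)
    (hy : intHeight y ≤ m) (hz : intHeight z ≤ m) :
    m ^ (-r) ≤ intHeight x ^ (-(r / 3)) * (intHeight y ^ (-(r / 3)) * intHeight z ^ (-(r / 3))) := by
  have hm : 0 < m := (intHeight_pos x).trans_le hx
  have key : ∀ w : ℤ, intHeight w ≤ m → m ^ (-(r / 3)) ≤ intHeight w ^ (-(r / 3)) := fun w hw =>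
    Real.rpow_le_rpow_of_nonpos (intHeight_pos w) hw (by linarith)
  have e : m ^ (-r) = m ^ (-(r / 3)) * (m ^ (-(r / 3)) * m ^ (-(r / 3))) := by
    rw [← Real.rpow_add hm, ← Real.rpow_add hm]
    congr 1
    ring
  rw [e]
  have := key x hx
  have := key y hy
  have := key z hz
  have := intHeight_pos x
  have := intHeight_pos y
  have := intHeight_pos z
  gcongr

/-- The nonzero integral vectors on the quadric `v₂² = v₁ v₃ - v₀ v₄`. -/
def isotropicInt : Set (Fin 5 → ℤ) := {v | v ≠ 0 ∧ v 2 ^ 2 = v 1 * v 3 - v 0 * v 4}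

theorem one_le_norm_of_ne_zero {v : Fin 5 → ℤ} (hv : v ≠ 0) : 1 ≤ ‖v‖ := by
  obtain ⟨i, hi⟩ := Function.ne_iff.1 hv
  refine le_trans ?_ (norm_le_pi_norm v i)
  rw [Int.norm_eq_abs]
  exact_mod_cast Int.one_le_abs hi

theorem intHeight_le_norm {v : Fin 5 → ℤ} (hv : v ≠ 0) (i : Fin 5) : intHeight (v i) ≤ ‖v‖ := by
  refine max_le (one_le_norm_of_ne_zero hv) ?_
  simpa [Int.norm_eq_abs] using norm_le_pi_norm v i

/-- Three coordinates and a sign embed the family in ℤ³ × {±}, where the exponent 4 > 3 suffices. -/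
theorem summable_isotropic_of_proj {ι : Type*} (u : ι → Fin 5 → ℤ) (hu : ∀ i, u i ≠ 0) (a b c : Fin 5)
    (d : Fin 5) (hinj : ∀ i j, u i a = u j a → u i b = u j b → u i c = u j c →
      (0 ≤ u i d ↔ 0 ≤ u j d) → i = j) :
    Summable fun i => ‖u i‖ ^ (-4 : ℝ) := by
  have h := summable_intHeight_prod (r := 4) (by norm_num)
  have hB : Summable fun x : (ℤ × ℤ × ℤ) × Bool => intHeight x.1.1 ^ (-(4 / 3 : ℝ)) *
      (intHeight x.1.2.1 ^ (-(4 / 3 : ℝ)) * intHeight x.1.2.2 ^ (-(4 / 3 : ℝ))) * 1 :=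
    h.mul_of_nonneg (g := fun _ : Bool => (1 : ℝ)) (hasSum_fintype _).summable
      (fun x => by
        have := intHeight_pos x.1
        have := intHeight_pos x.2.1
        have := intHeight_pos x.2.2
        positivity) (fun _ => zero_le_one)
  let φ : ι → (ℤ × ℤ × ℤ) × Bool := fun i => ((u i a, u i b, u i c), decide (0 ≤ u i d))
  have hφ : Function.Injective φ := by
    intro i j hij
    simp only [φ, Prod.mk.injEq, decide_eq_decide] at hij
    exact hinj i j hij.1.1 hij.1.2.1 hij.1.2.2 hij.2
  refine Summable.of_nonneg_of_le (fun i => by positivity) (fun i => ?_) (hB.comp_injective hφ)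
  simp only [Function.comp, φ, mul_one]
  exact rpow_neg_le_intHeight_prod (by norm_num) (intHeight_le_norm (hu i) _)
    (intHeight_le_norm (hu i) _) (intHeight_le_norm (hu i) _)

/-- The maximum of `1` and the absolute values of three integers. -/
def tripleHeight (t : ℤ × ℤ × ℤ) : ℝ := max (intHeight t.1) (max (intHeight t.2.1) (intHeight t.2.2))

theorem one_le_tripleHeight (t : ℤ × ℤ × ℤ) : 1 ≤ tripleHeight t :=
  (one_le_intHeight t.1).trans (le_max_left _ _)

theorem card_divisors_le_tripleHeight (t : ℤ × ℤ × ℤ) :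
    ((t.2.1 ^ 2 + t.1 * t.2.2).natAbs.divisors.card : ℝ) ≤ 32 * tripleHeight t ^ (2 / 3 : ℝ) := by
  have hm := one_le_tripleHeight t
  set m := tripleHeight t with hmdef
  have h1 : |(t.1 : ℝ)| ≤ m := (le_max_right _ _).trans (le_max_left _ _)
  have h2 : |(t.2.1 : ℝ)| ≤ m :=
    ((le_max_right _ _).trans (le_max_left _ _)).trans (le_max_right _ _)
  have h3 : |(t.2.2 : ℝ)| ≤ m :=
    ((le_max_right _ _).trans (le_max_right _ _)).trans (le_max_right _ _)
  -- The bound 2m² holds as well; 8 is used because its cube root is 2.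
  have hn : (((t.2.1 ^ 2 + t.1 * t.2.2).natAbs : ℕ) : ℝ) ≤ 8 * m ^ (2 : ℝ) := by
    rw [Nat.cast_natAbs]
    push_cast
    refine (abs_add_le _ _).trans ?_
    rw [abs_pow, abs_mul, Real.rpow_two]
    nlinarith [abs_nonneg (t.1 : ℝ), abs_nonneg (t.2.1 : ℝ), abs_nonneg (t.2.2 : ℝ),
      mul_le_mul h1 h3 (abs_nonneg _) (by linarith), mul_le_mul h2 h2 (abs_nonneg _) (by linarith)]
  calc _ ≤ 16 * (((t.2.1 ^ 2 + t.1 * t.2.2).natAbs : ℕ) : ℝ) ^ (1 / 3 : ℝ) :=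
        card_divisors_le_rpow _
    _ ≤ 16 * (8 * m ^ (2 : ℝ)) ^ (1 / 3 : ℝ) := by gcongr
    _ = 32 * m ^ (2 / 3 : ℝ) := by
      rw [Real.mul_rpow (by norm_num) (by positivity), ← Real.rpow_mul (by linarith),
        show (8 : ℝ) = 2 ^ (3 : ℝ) by norm_num, ← Real.rpow_mul (by norm_num)]
      norm_num
      ring

/-- Each triple carries at most a constant times m^{2/3} pairs of a divisor and a sign, so the
exponent drops from 4 to 10/3, still above 3. -/
theorem summable_tripleHeight_sigma :
    Summable fun x : Σ t : ℤ × ℤ × ℤ, {a // a ∈ (t.2.1 ^ 2 + t.1 * t.2.2).natAbs.divisors} × Bool =>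
      tripleHeight x.1 ^ (-4 : ℝ) := by
  have hpos : ∀ t, 0 < tripleHeight t := fun t => one_pos.trans_le (one_le_tripleHeight t)
  rw [summable_sigma_of_nonneg (fun x => Real.rpow_nonneg (hpos _).le _)]
  refine ⟨fun t => (hasSum_fintype _).summable, ?_⟩
  refine Summable.of_nonneg_of_le (fun t => tsum_nonneg fun _ => Real.rpow_nonneg (hpos _).le _)
    (fun t => ?_) ((summable_intHeight_prod (r := 10 / 3) (by norm_num)).mul_left 64)
  rw [tsum_fintype]
  dsimp only
  rw [Finset.sum_const, Finset.card_univ, nsmul_eq_mul, Fintype.card_prod,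
    Fintype.card_coe, Fintype.card_bool]
  push_cast
  calc _ ≤ 32 * tripleHeight t ^ (2 / 3 : ℝ) * 2 * tripleHeight t ^ (-4 : ℝ) := by
        gcongr
        · exact Real.rpow_nonneg (hpos _).le _
        · exact card_divisors_le_tripleHeight t
    _ = 64 * tripleHeight t ^ (-(10 / 3) : ℝ) := by
      rw [show (-(10 / 3) : ℝ) = 2 / 3 + -4 by norm_num, Real.rpow_add (hpos t)]
      ring
    _ ≤ _ := by
      gcongr
      exact rpow_neg_le_intHeight_prod (by norm_num) (le_max_left _ _)
        ((le_max_left _ _).trans (le_max_right _ _)) ((le_max_right _ _).trans (le_max_right _ _))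

theorem eq_of_sq_eq_of_nonneg_iff {x y : ℤ} (h : x ^ 2 = y ^ 2) (hs : 0 ≤ x ↔ 0 ≤ y) : x = y := by
  rcases sq_eq_sq_iff_eq_or_eq_neg.1 h with h | h <;> omega

/-- On the quadric v₁v₃ = v₂² + v₀v₄, so |v₁| is a divisor of a nonzero number given by (v₀, v₂,
v₄). With the sign of v₁ this recovers v₁ and then v₃. -/
theorem summable_isotropic_generic :
    Summable fun v : {v // v ∈ isotropicInt ∧ v 1 * v 3 ≠ 0} => ‖v.1‖ ^ (-4 : ℝ) := by
  have hmem : ∀ v : {v // v ∈ isotropicInt ∧ v 1 * v 3 ≠ 0},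
      (v.1 1).natAbs ∈ (v.1 2 ^ 2 + v.1 0 * v.1 4).natAbs.divisors := by
    intro v
    have h : v.1 2 ^ 2 + v.1 0 * v.1 4 = v.1 1 * v.1 3 := by rw [v.2.1.2]; ring
    rw [h, Nat.mem_divisors]
    exact ⟨by rw [Int.natAbs_mul]; exact Dvd.intro _ rfl, by simpa using v.2.2⟩
  let φ : {v // v ∈ isotropicInt ∧ v 1 * v 3 ≠ 0} →
      Σ t : ℤ × ℤ × ℤ, {a // a ∈ (t.2.1 ^ 2 + t.1 * t.2.2).natAbs.divisors} × Bool :=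
    fun v => ⟨(v.1 0, v.1 2, v.1 4), ⟨(v.1 1).natAbs, hmem v⟩, decide (0 ≤ v.1 1)⟩
  have hφ : Function.Injective φ := by
    intro v w h
    have h0 : (v.1 0, v.1 2, v.1 4) = (w.1 0, w.1 2, w.1 4) := congrArg Sigma.fst h
    have ha : (v.1 1).natAbs = (w.1 1).natAbs := congrArg (fun x => (x.2.1 : ℕ)) h
    have hb : decide (0 ≤ v.1 1) = decide (0 ≤ w.1 1) := congrArg (fun x => x.2.2) h
    simp only [Prod.mk.injEq] at h0
    rw [decide_eq_decide] at hb
    have h1 : v.1 1 = w.1 1 := by omega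
    have h3 : v.1 3 = w.1 3 := by
      have e1 := v.2.1.2
      have e2 := w.2.1.2
      rw [h0.1, h0.2.1, h0.2.2, h1] at e1
      exact mul_left_cancel₀ (left_ne_zero_of_mul w.2.2) (by linarith)
    apply Subtype.ext
    funext i
    fin_cases i
    exacts [h0.1, h1, h0.2.1, h3, h0.2.2]
  refine Summable.of_nonneg_of_le (fun i => by positivity) (fun v => ?_)
    (summable_tripleHeight_sigma.comp_injective hφ)
  have hle : tripleHeight (v.1 0, v.1 2, v.1 4) ≤ ‖v.1‖ :=
    max_le (intHeight_le_norm v.2.1.1 0)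
      (max_le (intHeight_le_norm v.2.1.1 2) (intHeight_le_norm v.2.1.1 4))
  exact Real.rpow_le_rpow_of_nonpos (one_pos.trans_le (one_le_tripleHeight _)) hle (by norm_num)

/-- If v₁v₃ = 0 then v₂² = -v₀v₄, so v₂ is known up to sign and no divisor bound is needed. -/
theorem summable_isotropic_degenerate (i j : Fin 5) (hij : i = 1 ∧ j = 3 ∨ i = 3 ∧ j = 1) :
    Summable fun v : {v // v ∈ isotropicInt ∧ v i = 0} => ‖v.1‖ ^ (-4 : ℝ) := by
  refine summable_isotropic_of_proj (fun v : {v // v ∈ isotropicInt ∧ v i = 0} => v.1)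
    (fun v => v.2.1.1) 0 4 j 2 ?_
  intro v w h0 h4 hj h2
  have e1 := v.2.1.2
  have e2 := w.2.1.2
  have z1 := v.2.2
  have z2 := w.2.2
  have h2' : v.1 2 = w.1 2 := by
    refine eq_of_sq_eq_of_nonneg_iff ?_ h2
    rw [e1, e2, h0, h4]
    rcases hij with ⟨rfl, rfl⟩ | ⟨rfl, rfl⟩ <;> simp [z1, z2]
  have hi : v.1 i = w.1 i := z1.trans z2.symm
  apply Subtype.ext
  funext l
  rcases hij with ⟨rfl, rfl⟩ | ⟨rfl, rfl⟩
  · fin_cases l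
    exacts [h0, hi, h2', hj, h4]
  · fin_cases l
    exacts [h0, hj, h2', hi, h4]

theorem summable_isotropic_norm :
    Summable fun v : isotropicInt => ‖v.1‖ ^ (-4 : ℝ) := by
  let f : (Fin 5 → ℤ) → ℝ := fun v => ‖v‖ ^ (-4 : ℝ)
  have h1 := (summable_subtype_iff_indicator (f := f)
    (s := {v | v ∈ isotropicInt ∧ v 1 * v 3 ≠ 0})).1 summable_isotropic_generic
  have h2 := (summable_subtype_iff_indicator (f := f)
    (s := {v | v ∈ isotropicInt ∧ v 1 = 0})).1 (summable_isotropic_degenerate 1 3 (by simp))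
  have h3 := (summable_subtype_iff_indicator (f := f)
    (s := {v | v ∈ isotropicInt ∧ v 3 = 0})).1 (summable_isotropic_degenerate 3 1 (by simp))
  -- The strata v₁ = 0 and v₃ = 0 overlap; a sum of indicators is still an upper bound.
  refine (summable_subtype_iff_indicator (f := f)).2 (Summable.of_nonneg_of_le ?_ ?_ ((h1.add h2).add h3))
  · intro v
    exact Set.indicator_nonneg (fun v _ => Real.rpow_nonneg (norm_nonneg v) _) v
  · intro v
    have hp : 0 ≤ f v := Real.rpow_nonneg (norm_nonneg v) _
    classical
    simp only [Set.indicator_apply, Set.mem_ofPred_eq]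
    by_cases hv : v ∈ isotropicInt
    · by_cases ha : v 1 = 0
      · by_cases hb : v 3 = 0 <;> simp [hv, ha, hb, hp]
      · by_cases hb : v 3 = 0 <;> simp [hv, ha, hb]
    · simp [hv]

theorem summable_isotropic_norm_rpow {κ : ℝ} (hκ : 4 ≤ κ) :
    Summable fun v : isotropicInt => ‖v.1‖ ^ (-κ) :=
  Summable.of_nonneg_of_le (fun _ => by positivity)
    (fun v => Real.rpow_le_rpow_of_exponent_le (one_le_norm_of_ne_zero v.2.1) (by linarith))
    summable_isotropic_norm

/-! ### Relations in the symplectic group -/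

theorem integral_row_relations (M : Γ₂) :
    M.1.toBlocks₂₁ * M.1.toBlocks₂₂ᵀ = M.1.toBlocks₂₂ * M.1.toBlocks₂₁ᵀ ∧
    M.1.toBlocks₁₁ * M.1.toBlocks₂₂ᵀ - M.1.toBlocks₁₂ * M.1.toBlocks₂₁ᵀ = 1 := by
  have hs := (SymplecticGroup.mem_iff (A := M.1)).1 M.2
  rw [← Matrix.fromBlocks_toBlocks M.1, Matrix.J, Matrix.fromBlocks_transpose,
    Matrix.fromBlocks_multiply, Matrix.fromBlocks_multiply] at hs
  obtain ⟨-, h12, -, h22⟩ := Matrix.fromBlocks_inj.1 hs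
  simp only [mul_zero, mul_one, mul_neg, zero_add, add_zero, neg_mul] at h12 h22
  constructor
  · exact (eq_of_sub_eq_zero (by rw [sub_eq_add_neg]; exact h22)).symm
  · rw [← neg_inj, ← h12]
    abel

theorem integral_column_relations (M : Γ₂) :
    M.1.toBlocks₂₁ᵀ * M.1.toBlocks₁₁ = M.1.toBlocks₁₁ᵀ * M.1.toBlocks₂₁ ∧
    M.1.toBlocks₂₂ᵀ * M.1.toBlocks₁₂ = M.1.toBlocks₁₂ᵀ * M.1.toBlocks₂₂ ∧
    M.1.toBlocks₂₂ᵀ * M.1.toBlocks₁₁ - M.1.toBlocks₁₂ᵀ * M.1.toBlocks₂₁ = 1 ∧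
    M.1.toBlocks₁₁ᵀ * M.1.toBlocks₂₂ - M.1.toBlocks₂₁ᵀ * M.1.toBlocks₁₂ = 1 := by
  have hs := (SymplecticGroup.mem_iff' (A := M.1)).1 M.2
  rw [← Matrix.fromBlocks_toBlocks M.1, Matrix.J, Matrix.fromBlocks_transpose,
    Matrix.fromBlocks_multiply, Matrix.fromBlocks_multiply] at hs
  obtain ⟨h11, h12, h21, h22⟩ := Matrix.fromBlocks_inj.1 hs
  simp only [mul_zero, mul_one, mul_neg, zero_add, add_zero, neg_mul] at h11 h12 h21 h22
  refine ⟨?_, ?_, ?_, ?_⟩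
  · exact eq_of_sub_eq_zero (by rw [sub_eq_add_neg]; exact h11)
  · exact eq_of_sub_eq_zero (by rw [sub_eq_add_neg]; exact h22)
  · rw [← h21]
    abel
  · rw [← neg_inj, ← h12]
    abel

theorem block_column_relations (M : Γ₂) :
    (blockC M)ᵀ * blockA M = (blockA M)ᵀ * blockC M ∧
    (blockD M)ᵀ * blockB M = (blockB M)ᵀ * blockD M ∧
    (blockD M)ᵀ * blockA M - (blockB M)ᵀ * blockC M = 1 ∧
    (blockA M)ᵀ * blockD M - (blockC M)ᵀ * blockB M = 1 := by
  obtain ⟨h1, h2, h3, h4⟩ := integral_column_relations M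
  let φ := (Int.castRingHom ℂ).mapMatrix (m := Fin 2)
  have e1 := congrArg φ h1
  have e2 := congrArg φ h2
  have e3 := congrArg φ h3
  have e4 := congrArg φ h4
  simp only [map_mul, map_sub, map_one] at e1 e2 e3 e4
  exact ⟨e1, e2, e3, e4⟩

/-- A polarised form of the symplectic relations: X = Z yields the symmetry of M∘Z, and X = Z̄
yields its imaginary part. -/
theorem symplectic_bilinear (M : Γ₂) (X Z : Mat2) (hX : X.IsSymm) :
    (blockC M * X + blockD M)ᵀ * (blockA M * Z + blockB M)
      - (blockA M * X + blockB M)ᵀ * (blockC M * Z + blockD M) = Z - X := by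
  obtain ⟨h1, h2, h3, h4⟩ := block_column_relations M
  simp only [Matrix.transpose_add, Matrix.transpose_mul, hX.eq]
  have : (X * (blockC M)ᵀ + (blockD M)ᵀ) * (blockA M * Z + blockB M)
      - (X * (blockA M)ᵀ + (blockB M)ᵀ) * (blockC M * Z + blockD M)
      = X * ((blockC M)ᵀ * blockA M - (blockA M)ᵀ * blockC M) * Z
        - X * ((blockA M)ᵀ * blockD M - (blockC M)ᵀ * blockB M)
        + ((blockD M)ᵀ * blockA M - (blockB M)ᵀ * blockC M) * Z
        + ((blockD M)ᵀ * blockB M - (blockB M)ᵀ * blockD M) := by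
    noncomm_ring
  rw [this, h1, h2, h3, h4]
  noncomm_ring

/-! ### The imaginary part of M∘Z -/

theorem det_sub_conj (W : Mat2) : (W - W.map conj).det = -4 * (detIm W : ℂ) := by
  have h : ∀ w : ℂ, w - conj w = 2 * Complex.I * (w.im : ℂ) := fun w => by
    rw [Complex.sub_conj]
    push_cast
    ring
  simp only [detIm, Matrix.det_fin_two, Matrix.sub_apply, Matrix.map_apply, h]
  push_cast
  linear_combination (4 * ((W 0 0).im * (W 1 1).im - (W 0 1).im * (W 1 0).im : ℂ)) * Complex.I_sq

theorem detIm_act (M : Γ₂) {Z : Mat2} (hZ : Z.IsSymm) (hJ : detJ M Z ≠ 0) :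
    detIm (act M Z) = detIm Z / ‖detJ M Z‖ ^ 2 := by
  set N := blockA M * Z + blockB M with hN
  set K := blockC M * Z + blockD M with hK
  have hKu : IsUnit K.det := isUnit_iff_ne_zero.2 hJ
  set W := act M Z with hW
  have hWK : W * K = N := by
    rw [hW, act, Matrix.mul_assoc, Matrix.nonsing_inv_mul _ hKu, Matrix.mul_one]
  have hsymm : Wᵀ = W := by
    have h := symplectic_bilinear M Z Z hZ
    rw [← hN, ← hK, ← hWK, Matrix.transpose_mul, sub_self] at h
    have h2 : Kᵀ * (W - Wᵀ) * K = 0 := by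
      rw [← h]
      noncomm_ring
    have hKt : IsUnit Kᵀ.det := by rwa [Matrix.det_transpose]
    have h3 : W - Wᵀ = (Kᵀ)⁻¹ * (Kᵀ * (W - Wᵀ) * K) * K⁻¹ := by
      rw [Matrix.mul_assoc Kᵀ, ← Matrix.mul_assoc (Kᵀ)⁻¹, Matrix.nonsing_inv_mul _ hKt,
        Matrix.one_mul, Matrix.mul_assoc, Matrix.mul_nonsing_inv _ hKu, Matrix.mul_one]
    rw [h2] at h3
    simpa using (sub_eq_zero.1 (by simpa using h3)).symm
  have cint : ∀ X : Matrix (Fin 2) (Fin 2) ℤ,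
      (X.map (Int.cast : ℤ → ℂ)).map conj = X.map (Int.cast : ℤ → ℂ) := fun X => by
    ext i j
    simp
  have hKc : blockC M * Z.map conj + blockD M = K.map conj := by
    rw [hK, Matrix.map_add conj (map_add _), Matrix.map_mul, blockC, blockD, cint, cint]
  have hNc : blockA M * Z.map conj + blockB M = N.map conj := by
    rw [hN, Matrix.map_add conj (map_add _), Matrix.map_mul, blockA, blockB, cint, cint]
  have hZc : (Z.map conj).IsSymm := by
    rw [Matrix.IsSymm, ← Matrix.transpose_map, hZ.eq]
  have h := symplectic_bilinear M (Z.map conj) Z hZc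
  rw [hKc, hNc, ← hN, ← hK, ← hWK, Matrix.map_mul, Matrix.transpose_mul,
    ← Matrix.transpose_map (M := W), hsymm] at h
  -- Since Z - Z̄ = 2iY, the determinant of this identity is the transformation law of det Y.
  have h2 : (K.map conj)ᵀ * (W - W.map conj) * K = Z - Z.map conj := by
    rw [← h]
    noncomm_ring
  have h3 := congrArg Matrix.det h2
  have hdc : (K.map conj).det = conj K.det := ((starRingEnd ℂ).map_det K).symm
  rw [Matrix.det_mul, Matrix.det_mul, Matrix.det_transpose, hdc, det_sub_conj, det_sub_conj] at h3
  have hKJ : K.det = detJ M Z := rfl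
  rw [hKJ] at h3
  have hn : (‖detJ M Z‖ : ℂ) ^ 2 = detJ M Z * conj (detJ M Z) := by
    rw [Complex.mul_conj, Complex.normSq_eq_norm_sq]
    push_cast
    rfl
  have h4 : (detIm W : ℂ) * (‖detJ M Z‖ : ℂ) ^ 2 = detIm Z := by
    rw [hn]
    linear_combination (-1 / 4 : ℂ) * h3
  have h5 : detIm W * ‖detJ M Z‖ ^ 2 = detIm Z := by exact_mod_cast h4
  rw [← h5, mul_div_cancel_right₀]
  simpa using hJ

/-! ### The vector of minors -/

/-- The value at `p = (τ, z, τ')` of the quadratic polynomial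
`v₀ (τ τ' - z²) + v₁ τ + 2 v₂ z + v₃ τ' + v₄`. -/
def quadJ (v : Fin 5 → ℝ) (p : ℂ × ℂ × ℂ) : ℂ :=
  v 0 * (p.1 * p.2.2 - p.2.1 ^ 2) + v 1 * p.1 + 2 * v 2 * p.2.1 + v 3 * p.2.2 + v 4

/-- The independent `2 × 2` minors of the lower half `(C D)` of a symplectic matrix. -/
def minors (M : Γ₂) : Fin 5 → ℤ :=
  let C := M.1.toBlocks₂₁
  let D := M.1.toBlocks₂₂
  ![C 0 0 * C 1 1 - C 1 0 * C 0 1, C 0 0 * D 1 1 - C 1 0 * D 0 1, C 0 1 * D 1 1 - C 1 1 * D 0 1,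
    D 0 0 * C 1 1 - D 1 0 * C 0 1, D 0 0 * D 1 1 - D 1 0 * D 0 1]

/-- The off-diagonal entry of CDᵀ = DCᵀ. It is the linear relation between two of the six minors of
(C D) that leaves five. -/
theorem row_pairing (M : Γ₂) :
    M.1.toBlocks₂₁ 0 0 * M.1.toBlocks₂₂ 1 0 + M.1.toBlocks₂₁ 0 1 * M.1.toBlocks₂₂ 1 1
      - M.1.toBlocks₂₂ 0 0 * M.1.toBlocks₂₁ 1 0 - M.1.toBlocks₂₂ 0 1 * M.1.toBlocks₂₁ 1 1 = 0 := by
  have h := congrFun (congrFun (integral_row_relations M).1 0) 1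
  simp only [Matrix.mul_apply, Fin.sum_univ_two, Matrix.transpose_apply] at h
  linear_combination h

theorem detJ_ofCoords (M : Γ₂) (p : ℂ × ℂ × ℂ) :
    detJ M (ofCoords p) = quadJ (fun i => (minors M i : ℝ)) p := by
  have h := congrArg (Int.cast : ℤ → ℂ) (row_pairing M)
  push_cast at h
  simp only [detJ, Matrix.det_fin_two, Matrix.add_apply, Matrix.mul_apply, Fin.sum_univ_two,
    blockC, blockD, Matrix.map_apply, ofCoords, quadJ, minors]
  simp
  linear_combination (-p.2.1) * h

/-- This is the Plücker relation of the 2×4 matrix (C D), with the sixth minor eliminated by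
`row_pairing`. -/
theorem minors_isotropic (M : Γ₂) :
    minors M 2 ^ 2 = minors M 1 * minors M 3 - minors M 0 * minors M 4 := by
  have h := row_pairing M
  simp only [minors]
  simp
  linear_combination (M.1.toBlocks₂₁ 0 1 * M.1.toBlocks₂₂ 1 1
    - M.1.toBlocks₂₁ 1 1 * M.1.toBlocks₂₂ 0 1) * h

/-- By Cauchy–Binet, 1 = det(ADᵀ - BCᵀ) is an integral combination of the minors of (C D). -/
theorem minors_ne_zero (M : Γ₂) : minors M ≠ 0 := by
  intro h0
  have h := congrArg Matrix.det (integral_row_relations M).2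
  have hr := row_pairing M
  have e0 := congrFun h0 0
  have e1 := congrFun h0 1
  have e2 := congrFun h0 2
  have e3 := congrFun h0 3
  have e4 := congrFun h0 4
  simp only [minors] at e0 e1 e2 e3 e4
  simp at e0 e1 e2 e3 e4
  simp only [Matrix.det_fin_two, Matrix.sub_apply, Matrix.mul_apply, Fin.sum_univ_two,
    Matrix.transpose_apply, Matrix.one_apply] at h
  simp at h
  generalize M.1.toBlocks₁₁ = A at *
  generalize M.1.toBlocks₁₂ = B at *
  generalize M.1.toBlocks₂₁ = C at *
  generalize M.1.toBlocks₂₂ = D at *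
  have h1 : C 0 0 * D 1 0 - C 1 0 * D 0 0 = 0 := by linear_combination hr - e2
  have : (1 : ℤ) = 0 := by
    rw [← h]
    linear_combination (A 0 0 * A 1 1 - A 0 1 * A 1 0) * e4
      + (A 0 0 * B 1 0 - A 1 0 * B 0 0) * h1 + (A 1 0 * B 0 1 - A 0 0 * B 1 1) * e3
      + (A 0 1 * B 1 0 - A 1 1 * B 0 0) * e1 + (A 0 1 * B 1 1 - A 1 1 * B 0 1) * e2
      + (B 0 0 * B 1 1 - B 0 1 * B 1 0) * e0
  exact one_ne_zero this

/-! ### Recovering the coset from its minors -/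

/-- The standard symplectic form on `ℤ⁴`. -/
def pairing (a b : Fin 4 → ℤ) : ℤ := a 0 * b 2 + a 1 * b 3 - a 2 * b 0 - a 3 * b 1

/-- Contracting n₁ ∧ n₂ = m₁ ∧ m₂ with b gives ⟨n₁,b⟩n₂ - ⟨n₂,b⟩n₁ = 0, and n₁, n₂ are linearly
independent. -/
theorem pairing_eq_zero {n₁ n₂ m₁ m₂ b : Fin 4 → ℤ}
    (H : ∀ l h, n₁ l * n₂ h - n₁ h * n₂ l = m₁ l * m₂ h - m₁ h * m₂ l)
    (hne : ∃ l h, n₁ l * n₂ h - n₁ h * n₂ l ≠ 0) (h₁ : pairing m₁ b = 0) (h₂ : pairing m₂ b = 0) :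
    pairing n₁ b = 0 ∧ pairing n₂ b = 0 := by
  have key : ∀ l, pairing n₁ b * n₂ l - pairing n₂ b * n₁ l = 0 := by
    intro l
    have e : pairing m₁ b * m₂ l - pairing m₂ b * m₁ l = 0 := by rw [h₁, h₂]; ring
    rw [← e]
    simp only [pairing]
    linear_combination b 2 * H 0 l + b 3 * H 1 l - b 0 * H 2 l - b 1 * H 3 l
  obtain ⟨l, h, hlh⟩ := hne
  constructor
  · refine (mul_eq_zero.1 (?_ : pairing n₁ b * (n₁ l * n₂ h - n₁ h * n₂ l) = 0)).resolve_right hlh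
    linear_combination n₁ l * key h - n₁ h * key l
  · refine (mul_eq_zero.1 (?_ : pairing n₂ b * (n₁ l * n₂ h - n₁ h * n₂ l) = 0)).resolve_right hlh
    linear_combination n₂ l * key h - n₂ h * key l

/-- The rows of the lower half of a symplectic matrix. -/
def lowerRow (M : Γ₂) (i : Fin 2) : Fin 4 → ℤ :=
  ![M.1.toBlocks₂₁ i 0, M.1.toBlocks₂₁ i 1, M.1.toBlocks₂₂ i 0, M.1.toBlocks₂₂ i 1]

theorem lowerRow_minors (M : Γ₂) (l h : Fin 4) :
    lowerRow M 0 l * lowerRow M 1 h - lowerRow M 0 h * lowerRow M 1 l =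
      !![0, minors M 0, -minors M 2, minors M 1; -minors M 0, 0, -minors M 3, minors M 2;
        minors M 2, minors M 3, 0, minors M 4; -minors M 1, -minors M 2, -minors M 4, 0] l h := by
  have hr := row_pairing M
  fin_cases l <;> fin_cases h <;> simp [lowerRow, minors] <;> linarith

/-- The lower left block of NM⁻¹ consists of the symplectic pairings of the lower rows of N with
those of M. Equal minors mean that both pairs of rows span the same plane, and this plane is
isotropic. -/
theorem rightRel_of_minors_eq {M N : Γ₂} (h : minors M = minors N) :
    QuotientGroup.rightRel ΓInf M N := by
  rw [QuotientGroup.rightRel_apply]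
  change (N.1 * (-Matrix.J (Fin 2) ℤ * M.1ᵀ * Matrix.J (Fin 2) ℤ)).toBlocks₂₁ = 0
  have hC : (N.1 * (-Matrix.J (Fin 2) ℤ * M.1ᵀ * Matrix.J (Fin 2) ℤ)).toBlocks₂₁
      = N.1.toBlocks₂₁ * M.1.toBlocks₂₂ᵀ - N.1.toBlocks₂₂ * M.1.toBlocks₂₁ᵀ := by
    conv_lhs => rw [← Matrix.fromBlocks_toBlocks M.1, ← Matrix.fromBlocks_toBlocks N.1]
    rw [Matrix.fromBlocks_transpose, Matrix.J, Matrix.fromBlocks_neg, Matrix.fromBlocks_multiply,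
      Matrix.fromBlocks_multiply, Matrix.fromBlocks_multiply]
    simp [sub_eq_add_neg]
  rw [hC]
  have H : ∀ l h, lowerRow N 0 l * lowerRow N 1 h - lowerRow N 0 h * lowerRow N 1 l
      = lowerRow M 0 l * lowerRow M 1 h - lowerRow M 0 h * lowerRow M 1 l := by
    intro l h'
    rw [lowerRow_minors, lowerRow_minors, h]
  have hne : ∃ l h, lowerRow N 0 l * lowerRow N 1 h - lowerRow N 0 h * lowerRow N 1 l ≠ 0 := by
    by_contra! hcon
    apply minors_ne_zero N
    funext i
    have c := fun l h => (lowerRow_minors N l h).symm.trans (hcon l h)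
    fin_cases i
    · simpa using c 0 1
    · simpa using c 0 3
    · simpa using c 1 3
    · simpa using c 2 1
    · simpa using c 2 3
  have hself : ∀ b, pairing b b = 0 := fun b => by simp only [pairing]; ring
  have h01 : pairing (lowerRow M 0) (lowerRow M 1) = 0 := by
    have := row_pairing M
    simp only [pairing, lowerRow]
    simp
    linear_combination this
  have h10 : pairing (lowerRow M 1) (lowerRow M 0) = 0 := by
    simp only [pairing] at h01 ⊢
    linear_combination -h01
  have r0 := pairing_eq_zero (b := lowerRow M 0) H hne (hself _) h10
  have r1 := pairing_eq_zero (b := lowerRow M 1) H hne h01 (hself _)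
  simp only [pairing, lowerRow] at r0 r1
  simp at r0 r1
  ext i j
  simp only [Matrix.sub_apply, Matrix.mul_apply, Fin.sum_univ_two, Matrix.transpose_apply,
    Matrix.zero_apply]
  fin_cases i <;> fin_cases j <;> simp
  · linear_combination r0.1
  · linear_combination r1.1
  · linear_combination r0.2
  · linear_combination r1.2

theorem minors_mem_isotropicInt (M : Γ₂) : minors M ∈ isotropicInt :=
  ⟨minors_ne_zero M, minors_isotropic M⟩

theorem minors_out_injective :
    Function.Injective fun q : CosetSpace =>
      (⟨minors q.out, minors_mem_isotropicInt q.out⟩ : isotropicInt) := by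
  intro q r h
  have h' : minors q.out = minors r.out := congrArg Subtype.val h
  exact Quotient.out_equiv_out.1 (rightRel_of_minors_eq h')

/-! ### The half space in coordinates -/

/-- `det Y` in coordinates. -/
def coordDetIm (p : ℂ × ℂ × ℂ) : ℝ := p.1.im * p.2.2.im - p.2.1.im ^ 2

theorem detIm_ofCoords (p : ℂ × ℂ × ℂ) : detIm (ofCoords p) = coordDetIm p := by
  simp [detIm, ofCoords, coordDetIm, Matrix.det_fin_two]
  ring

theorem ofCoords_isSymm (p : ℂ × ℂ × ℂ) : (ofCoords p).IsSymm := by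
  ext i j
  fin_cases i <;> fin_cases j <;> rfl

theorem exists_ofCoords_eq {Z : Mat2} (hZ : Z ∈ siegelH2) : ∃ p, ofCoords p = Z := by
  refine ⟨(Z 0 0, Z 0 1, Z 1 1), ?_⟩
  have h : Z 1 0 = Z 0 1 := hZ.1.apply 0 1
  ext i j
  fin_cases i <;> fin_cases j <;> simp [ofCoords, h]

theorem mem_preimage_siegelH2 {p : ℂ × ℂ × ℂ} :
    p ∈ ofCoords ⁻¹' siegelH2 ↔ 0 < p.1.im ∧ 0 < coordDetIm p := by
  constructor
  · rintro ⟨-, h⟩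
    refine ⟨?_, ?_⟩
    · simpa [ofCoords] using h.diag_pos (i := 0)
    · rw [← detIm_ofCoords]
      exact h.det_pos
  · rintro ⟨h1, h2⟩
    refine ⟨ofCoords_isSymm p, ?_⟩
    refine Matrix.PosDef.of_dotProduct_mulVec_pos ?_ ?_
    · ext i j
      fin_cases i <;> fin_cases j <;> simp [ofCoords]
    · intro x hx
      have e : star x ⬝ᵥ ((ofCoords p).map Complex.im).mulVec x
          = p.1.im * x 0 ^ 2 + 2 * p.2.1.im * x 0 * x 1 + p.2.2.im * x 1 ^ 2 := by
        simp [ofCoords, dotProduct, Matrix.mulVec, Fin.sum_univ_two]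
        ring
      rw [e]
      refine pos_of_mul_pos_right (a := p.1.im) ?_ h1.le
      -- Completing the square after multiplication by Im τ.
      have e2 : p.1.im * (p.1.im * x 0 ^ 2 + 2 * p.2.1.im * x 0 * x 1 + p.2.2.im * x 1 ^ 2)
          = (p.1.im * x 0 + p.2.1.im * x 1) ^ 2 + coordDetIm p * x 1 ^ 2 := by
        simp only [coordDetIm]
        ring
      rw [e2]
      by_cases h : x 1 = 0
      · have h0 : x 0 ≠ 0 := by
          intro h0
          apply hx
          funext i
          fin_cases i
          exacts [h0, h]
        rw [h]
        have : 0 < (p.1.im * x 0) ^ 2 := by positivity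
        simpa using this
      · positivity

theorem continuous_coordDetIm : Continuous coordDetIm := by
  unfold coordDetIm
  fun_prop

theorem isOpen_preimage_siegelH2 : IsOpen (ofCoords ⁻¹' siegelH2) := by
  have h : ofCoords ⁻¹' siegelH2
      = {p : ℂ × ℂ × ℂ | 0 < p.1.im} ∩ {p : ℂ × ℂ × ℂ | 0 < coordDetIm p} := by
    ext p
    exact mem_preimage_siegelH2
  rw [h]
  exact (isOpen_lt continuous_const (by fun_prop)).inter
    (isOpen_lt continuous_const continuous_coordDetIm)

/-- The nonzero real vectors on the quadric `v₂² = v₁ v₃ - v₀ v₄`. -/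
def isotropicReal : Set (Fin 5 → ℝ) := {v | v ≠ 0 ∧ v 2 ^ 2 = v 1 * v 3 - v 0 * v 4}

/-- For v₀ ≠ 0, v₀J is the determinant of v₀Z + S with S real symmetric, and a symmetric matrix with
definite imaginary part is invertible. For v₀ = 0, Im J is the trace of Y against a semidefinite
matrix of rank at most one, which kills v₁, v₂, v₃ and then v₄. -/
theorem quadJ_ne_zero {v : Fin 5 → ℝ} (hv : v ∈ isotropicReal) {p : ℂ × ℂ × ℂ}
    (hp : p ∈ ofCoords ⁻¹' siegelH2) : quadJ v p ≠ 0 := by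
  obtain ⟨h1, h2⟩ := mem_preimage_siegelH2.1 hp
  obtain ⟨hne, hiso⟩ := hv
  intro h0
  have hre := congrArg Complex.re h0
  have him := congrArg Complex.im h0
  simp [quadJ, pow_two] at hre him
  simp only [coordDetIm] at h2
  generalize p.1.re = a1, p.1.im = b1, p.2.1.re = a2, p.2.1.im = b2, p.2.2.re = a3,
    p.2.2.im = b3 at *
  by_cases hv0 : v 0 = 0
  · rw [hv0] at hre him hiso
    have e : (v 1 * b1 + v 2 * b2) ^ 2 + v 2 ^ 2 * (b1 * b3 - b2 ^ 2) = 0 := by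
      linear_combination b1 * v 1 * him + b1 * b3 * hiso
    have e2 : v 2 ^ 2 * (b1 * b3 - b2 ^ 2) = 0 := by
      nlinarith [sq_nonneg (v 1 * b1 + v 2 * b2), mul_nonneg (sq_nonneg (v 2)) h2.le]
    have hv2 : v 2 = 0 := by
      rcases mul_eq_zero.1 e2 with h | h
      · exact pow_eq_zero_iff two_ne_zero |>.1 h
      · exact absurd h h2.ne'
    have hv1 : v 1 = 0 := by
      rw [hv2] at e
      have : (v 1 * b1) ^ 2 = 0 := by linear_combination e
      rcases mul_eq_zero.1 (pow_eq_zero_iff two_ne_zero |>.1 this) with h | h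
      · exact h
      · exact absurd h h1.ne'
    have hb3 : 0 < b3 := by
      by_contra! hcon
      nlinarith [sq_nonneg b2, mul_nonneg h1.le (neg_nonneg.2 hcon)]
    have hv3 : v 3 = 0 := by
      rw [hv1, hv2] at him
      rcases mul_eq_zero.1 (by linear_combination him : v 3 * b3 = 0) with h | h
      · exact h
      · exact absurd h hb3.ne'
    have hv4 : v 4 = 0 := by
      rw [hv1, hv2, hv3] at hre
      linear_combination hre
    apply hne
    funext i
    fin_cases i
    exacts [hv0, hv1, hv2, hv3, hv4]
  -- x1, x2, x3 are the entries of Re(v₀Z + S), S = (v₃, -v₂; -v₂, v₁); the quadric equation gives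
  -- det S = v₀v₄.
  · set x1 := v 0 * a1 + v 3 with hx1
    set x3 := v 0 * a3 + v 1 with hx3
    set x2 := v 0 * a2 - v 2 with hx2
    have hδ : 0 < v 0 ^ 2 * (b1 * b3 - b2 ^ 2) := by positivity
    have er : x1 * x3 - x2 ^ 2 = v 0 ^ 2 * (b1 * b3 - b2 ^ 2) := by
      rw [hx1, hx2, hx3]
      linear_combination v 0 * hre - hiso
    have ei : x1 * (v 0 * b3) + x3 * (v 0 * b1) = 2 * x2 * (v 0 * b2) := by
      rw [hx1, hx2, hx3]
      linear_combination v 0 * him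
    have e4 : (x1 * (v 0 * b3) - x3 * (v 0 * b1)) ^ 2
        + 4 * (v 0 ^ 2 * (b1 * b3 - b2 ^ 2)) * (x2 ^ 2 + (v 0 * b2) ^ 2
          + v 0 ^ 2 * (b1 * b3 - b2 ^ 2)) = 0 := by
      linear_combination (x1 * (v 0 * b3) + x3 * (v 0 * b1) + 2 * x2 * (v 0 * b2)) * ei
        - 4 * v 0 ^ 2 * b1 * b3 * er
    have e5 : 0 < 4 * (v 0 ^ 2 * (b1 * b3 - b2 ^ 2)) * (x2 ^ 2 + (v 0 * b2) ^ 2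
          + v 0 ^ 2 * (b1 * b3 - b2 ^ 2)) := by positivity
    nlinarith [sq_nonneg (x1 * (v 0 * b3) - x3 * (v 0 * b1))]

/-! ### The general term -/

/-- The function `(det Y)^s |J|^{-1-2s} conj(J)^{1-k}`, where `J = quadJ v`. -/
def isoTerm (s : ℝ) (k : ℤ) (v : Fin 5 → ℝ) (p : ℂ × ℂ × ℂ) : ℂ :=
  ((coordDetIm p ^ s : ℝ) : ℂ) * ((‖quadJ v p‖ ^ (-1 - 2 * s) : ℝ) : ℂ) * conj (quadJ v p) ^ (1 - k)

/-- This homogeneity converts bounds on the unit sphere into decay in v. -/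
theorem isoTerm_smul (s : ℝ) (k : ℤ) {c : ℝ} (hc : 0 < c) (v : Fin 5 → ℝ) :
    isoTerm s k (c • v) = (c ^ (-(2 * s + k)) : ℝ) • isoTerm s k v := by
  funext p
  have hJ : quadJ (c • v) p = c * quadJ v p := by
    simp only [quadJ, Pi.smul_apply, smul_eq_mul]
    push_cast
    ring
  have hc' : (c ^ (-(2 * s + k)) : ℝ) = c ^ (-1 - 2 * s) * c ^ (1 - k) := by
    rw [← Real.rpow_intCast, ← Real.rpow_add hc]
    congr 1
    push_cast
    ring
  rw [Pi.smul_apply, isoTerm, isoTerm, hJ, hc', norm_mul, Complex.norm_real, Real.norm_of_nonneg hc.le,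
    Real.mul_rpow hc.le (norm_nonneg _), map_mul, Complex.conj_ofReal, mul_zpow, Complex.real_smul]
  push_cast
  ring

theorem contDiffAt_complex_zpow {F : Type*} [NormedAddCommGroup F] [NormedSpace ℝ F] {f : F → ℂ} {x : F}
    {n : WithTop ℕ∞} (hf : ContDiffAt ℝ n f x) (hx : f x ≠ 0) (m : ℤ) :
    ContDiffAt ℝ n (fun y => f y ^ m) x := by
  cases m with
  | ofNat m => simpa using hf.pow m
  | negSucc m =>
    simp only [zpow_negSucc]
    exact (hf.pow (m + 1)).inv (pow_ne_zero _ hx)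

theorem contDiff_quadJ {n : WithTop ℕ∞} :
    ContDiff ℝ n fun x : (Fin 5 → ℝ) × (ℂ × ℂ × ℂ) => quadJ x.1 x.2 := by
  have h : ∀ i, ContDiff ℝ n fun x : (Fin 5 → ℝ) × (ℂ × ℂ × ℂ) => ((x.1 i : ℝ) : ℂ) := fun i =>
    Complex.ofRealCLM.contDiff.comp ((contDiff_apply ℝ ℝ i).comp contDiff_fst)
  have h0 := h 0
  have h1 := h 1
  have h2 := h 2
  have h3 := h 3
  have h4 := h 4
  unfold quadJ
  fun_prop

theorem contDiff_coordDetIm {n : WithTop ℕ∞} : ContDiff ℝ n coordDetIm := by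
  have h : ContDiff ℝ n Complex.im := Complex.imCLM.contDiff
  unfold coordDetIm
  fun_prop

theorem contDiffAt_isoTerm (s : ℝ) (k : ℤ) {n : WithTop ℕ∞} {x : (Fin 5 → ℝ) × (ℂ × ℂ × ℂ)}
    (hJ : quadJ x.1 x.2 ≠ 0) (hy : coordDetIm x.2 ≠ 0) :
    ContDiffAt ℝ n (fun x : (Fin 5 → ℝ) × (ℂ × ℂ × ℂ) => isoTerm s k x.1 x.2) x := by
  have h1 : ContDiffAt ℝ n (fun x : (Fin 5 → ℝ) × (ℂ × ℂ × ℂ) => coordDetIm x.2 ^ s) x :=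
    (contDiff_coordDetIm.comp contDiff_snd).contDiffAt.rpow_const_of_ne hy
  have h2 : ContDiffAt ℝ n
      (fun x : (Fin 5 → ℝ) × (ℂ × ℂ × ℂ) => ‖quadJ x.1 x.2‖ ^ (-1 - 2 * s)) x :=
    (contDiff_quadJ.contDiffAt.norm ℝ hJ).rpow_const_of_ne (norm_ne_zero_iff.2 hJ)
  have h3 : ContDiffAt ℝ n (fun x : (Fin 5 → ℝ) × (ℂ × ℂ × ℂ) => conj (quadJ x.1 x.2)) x :=
    Complex.conjCLE.contDiff.contDiffAt.comp x contDiff_quadJ.contDiffAt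
  exact ((Complex.ofRealCLM.contDiff.contDiffAt.comp x h1).mul
    (Complex.ofRealCLM.contDiff.contDiffAt.comp x h2)).mul
      (contDiffAt_complex_zpow h3 (by simpa using hJ) _)

theorem contDiffAt_isoTerm_right (s : ℝ) (k : ℤ) {n : WithTop ℕ∞} {v : Fin 5 → ℝ} {p : ℂ × ℂ × ℂ}
    (hv : v ∈ isotropicReal) (hp : p ∈ ofCoords ⁻¹' siegelH2) :
    ContDiffAt ℝ n (isoTerm s k v) p :=
  (contDiffAt_isoTerm s k (x := (v, p)) (quadJ_ne_zero hv hp) (mem_preimage_siegelH2.1 hp).2.ne').comp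
    p (contDiff_prodMk_right v).contDiffAt

/-! ### Uniform bounds for the general term and its derivatives -/

/-- Derivatives in the point alone must be continuous jointly with the parameter v, so that
compactness bounds them uniformly in v. -/
theorem contDiffAt_fderiv_param {V E G : Type*} [NormedAddCommGroup V] [NormedSpace ℝ V]
    [NormedAddCommGroup E] [NormedSpace ℝ E] [NormedAddCommGroup G] [NormedSpace ℝ G]
    {f : V → E → G} {x : V × E} {m n : WithTop ℕ∞}
    (hf : ContDiffAt ℝ n (fun x : V × E => f x.1 x.2) x) (hmn : m + 1 ≤ n) :
    ContDiffAt ℝ m (fun x : V × E => fderiv ℝ (f x.1) x.2) x := by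
  refine ContDiffAt.fderiv (f := fun (x : V × E) (q : E) => f x.1 q) (g := Prod.snd) (n := n) ?_
    contDiffAt_snd hmn
  exact ContDiffAt.comp (x, x.2) (g := fun x : V × E => f x.1 x.2)
    (f := fun y : (V × E) × E => (y.1.1, y.2)) hf (by fun_prop)

theorem fderiv_fderiv_const_smul {E G : Type*} [NormedAddCommGroup E] [NormedSpace ℝ E]
    [NormedAddCommGroup G] [NormedSpace ℝ G] (c : ℝ) (f : E → G)
    (x : E) : fderiv ℝ (fderiv ℝ (c • f)) x = c • fderiv ℝ (fderiv ℝ f) x := by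
  rw [fderiv_const_smul_field]
  exact congrFun (fderiv_const_smul_field (f := fderiv ℝ f) c) x

theorem norm_smul_le_of_le {F : Type*} [NormedAddCommGroup F] [NormedSpace ℝ F] {c C : ℝ}
    (hc : 0 ≤ c) {y : F} (hy : ‖y‖ ≤ C) : ‖c • y‖ ≤ C * c := by
  rw [norm_smul, Real.norm_of_nonneg hc, mul_comm]
  exact mul_le_mul_of_nonneg_right hy hc

theorem norm_fderiv_const_smul_le {E G : Type*} [NormedAddCommGroup E] [NormedSpace ℝ E]
    [NormedAddCommGroup G] [NormedSpace ℝ G] {c C : ℝ} (hc : 0 ≤ c) {f : E → G} {x : E}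
    (h : ‖fderiv ℝ f x‖ ≤ C ∧ ‖fderiv ℝ (fderiv ℝ f) x‖ ≤ C) :
    ‖fderiv ℝ (c • f) x‖ ≤ C * c ∧ ‖fderiv ℝ (fderiv ℝ (c • f)) x‖ ≤ C * c := by
  rw [fderiv_fderiv_const_smul, fderiv_const_smul_field]
  refine ⟨norm_smul_le_of_le hc h.1, (ContinuousLinearMap.opNorm_smul_le c _).trans ?_⟩
  rw [Real.norm_of_nonneg hc, mul_comm]
  exact mul_le_mul_of_nonneg_right h.2 hc

/-- The vectors of norm one on the quadric `v₂² = v₁ v₃ - v₀ v₄`. -/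
def isotropicSphere : Set (Fin 5 → ℝ) := {v | ‖v‖ = 1 ∧ v 2 ^ 2 = v 1 * v 3 - v 0 * v 4}

theorem isCompact_isotropicSphere : IsCompact isotropicSphere := by
  have h : isotropicSphere = Metric.sphere 0 1 ∩ {v | v 2 ^ 2 = v 1 * v 3 - v 0 * v 4} := by
    ext v
    simp [isotropicSphere]
  rw [h]
  exact (isCompact_sphere _ _).inter_right (isClosed_eq (by fun_prop) (by fun_prop))

theorem isotropicSphere_subset : isotropicSphere ⊆ isotropicReal := fun v hv =>
  ⟨fun h0 => by simpa [h0] using hv.1, hv.2⟩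

theorem exists_bound_of_contDiffAt {V E G : Type*} [NormedAddCommGroup V] [NormedSpace ℝ V]
    [NormedAddCommGroup E] [NormedSpace ℝ E] [NormedAddCommGroup G] [NormedSpace ℝ G]
    {f : V → E → G} {K : Set (V × E)} (hK : IsCompact K)
    (hf : ∀ x ∈ K, ContDiffAt ℝ 2 (fun x : V × E => f x.1 x.2) x) :
    ∃ C, ∀ x ∈ K, ‖f x.1 x.2‖ ≤ C ∧ ‖fderiv ℝ (f x.1) x.2‖ ≤ C ∧
      ‖fderiv ℝ (fderiv ℝ (f x.1)) x.2‖ ≤ C := by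
  obtain ⟨C₀, h0⟩ := hK.exists_bound_of_continuousOn (f := fun x : V × E => f x.1 x.2)
    fun x hx => (hf x hx).continuousAt.continuousWithinAt
  obtain ⟨C₁, h1⟩ := hK.exists_bound_of_continuousOn (f := fun x : V × E => fderiv ℝ (f x.1) x.2)
    fun x hx => (contDiffAt_fderiv_param (m := 1) (hf x hx)
      (by norm_num)).continuousAt.continuousWithinAt
  obtain ⟨C₂, h2⟩ := hK.exists_bound_of_continuousOn
    (f := fun x : V × E => fderiv ℝ (fderiv ℝ (f x.1)) x.2)
    fun x hx => (contDiffAt_fderiv_param (m := 0) (f := fun v => fderiv ℝ (f v))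
      (contDiffAt_fderiv_param (m := 1) (hf x hx) (by norm_num))
      (by norm_num)).continuousAt.continuousWithinAt
  exact ⟨max C₀ (max C₁ C₂), fun x hx => ⟨(h0 x hx).trans (le_max_left _ _),
    (h1 x hx).trans ((le_max_left _ _).trans (le_max_right _ _)),
    (h2 x hx).trans ((le_max_right _ _).trans (le_max_right _ _))⟩⟩

theorem exists_isoTerm_bound (s : ℝ) (k : ℤ) {p₀ : ℂ × ℂ × ℂ} (hp₀ : p₀ ∈ ofCoords ⁻¹' siegelH2) :
    ∃ r > 0, ∃ C : ℝ, Metric.ball p₀ r ⊆ ofCoords ⁻¹' siegelH2 ∧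
      ∀ v ∈ isotropicReal, ∀ p ∈ Metric.ball p₀ r,
        ‖isoTerm s k v p‖ ≤ C * ‖v‖ ^ (-(2 * s + k)) ∧
        ‖fderiv ℝ (isoTerm s k v) p‖ ≤ C * ‖v‖ ^ (-(2 * s + k)) ∧
        ‖fderiv ℝ (fderiv ℝ (isoTerm s k v)) p‖ ≤ C * ‖v‖ ^ (-(2 * s + k)) := by
  obtain ⟨r, hr, hrU⟩ := Metric.nhds_basis_closedBall.mem_iff.1
    (isOpen_preimage_siegelH2.mem_nhds hp₀)
  obtain ⟨C, hC⟩ := exists_bound_of_contDiffAt (f := isoTerm s k)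
    (isCompact_isotropicSphere.prod (isCompact_closedBall p₀ r)) fun x hx =>
      contDiffAt_isoTerm s k (quadJ_ne_zero (isotropicSphere_subset hx.1) (hrU hx.2))
        (mem_preimage_siegelH2.1 (hrU hx.2)).2.ne'
  refine ⟨r, hr, C, Metric.ball_subset_closedBall.trans hrU, ?_⟩
  intro v hv p hp
  have hn : 0 < ‖v‖ := norm_pos_iff.2 hv.1
  obtain ⟨u, hu⟩ : ∃ u, u = ‖v‖⁻¹ • v := ⟨_, rfl⟩
  have huS : u ∈ isotropicSphere := by
    refine ⟨by rw [hu, norm_smul, norm_inv, norm_norm, inv_mul_cancel₀ hn.ne'], ?_⟩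
    simp only [hu, Pi.smul_apply, smul_eq_mul]
    linear_combination (‖v‖⁻¹) ^ 2 * hv.2
  have hvu : v = ‖v‖ • u := by rw [hu, smul_smul, mul_inv_cancel₀ hn.ne', one_smul]
  obtain ⟨h0, h1, h2⟩ := hC (u, p) ⟨huS, Metric.ball_subset_closedBall hp⟩
  have hc0 : 0 ≤ ‖v‖ ^ (-(2 * s + k)) := by positivity
  have hT : isoTerm s k v = ‖v‖ ^ (-(2 * s + k)) • isoTerm s k u := by
    conv_lhs => rw [hvu]
    rw [isoTerm_smul s k hn]
  generalize ‖v‖ ^ (-(2 * s + k)) = c at hT hc0 ⊢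
  rw [hT]
  exact ⟨norm_smul_le_of_le hc0 h0, norm_fderiv_const_smul_le hc0 ⟨h1, h2⟩⟩

/-! ### Twice differentiable series -/

section Series

variable {ι E G : Type*} [NormedAddCommGroup E] [NormedSpace ℝ E] [NormedAddCommGroup G]
  [NormedSpace ℝ G] [CompleteSpace G] {f : ι → E → G} {x₀ x : E} {r : ℝ} {u : ι → ℝ}

theorem hasFDerivAt_tsum_ball (hu : Summable u)
    (hf : ∀ i, ∀ x ∈ Metric.ball x₀ r, DifferentiableAt ℝ (f i) x)
    (h0 : ∀ i, ∀ x ∈ Metric.ball x₀ r, ‖f i x‖ ≤ u i)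
    (h1 : ∀ i, ∀ x ∈ Metric.ball x₀ r, ‖fderiv ℝ (f i) x‖ ≤ u i) (hx : x ∈ Metric.ball x₀ r) :
    HasFDerivAt (fun y => ∑' i, f i y) (∑' i, fderiv ℝ (f i) x) x :=
  hasFDerivAt_tsum_of_isPreconnected hu Metric.isOpen_ball (convex_ball x₀ r).isPreconnected
    (fun i x hx => (hf i x hx).hasFDerivAt) h1 hx (Summable.of_norm_bounded hu fun i => h0 i x hx) hx

theorem summable_fderiv_of_bound (hu : Summable u)
    (h1 : ∀ i, ∀ x ∈ Metric.ball x₀ r, ‖fderiv ℝ (f i) x‖ ≤ u i) (hx : x ∈ Metric.ball x₀ r) :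
    Summable fun i => fderiv ℝ (f i) x :=
  Summable.of_norm_bounded hu fun i => h1 i x hx

theorem fderiv_tsum_eventuallyEq (hu : Summable u)
    (hf : ∀ i, ∀ x ∈ Metric.ball x₀ r, DifferentiableAt ℝ (f i) x)
    (h0 : ∀ i, ∀ x ∈ Metric.ball x₀ r, ‖f i x‖ ≤ u i)
    (h1 : ∀ i, ∀ x ∈ Metric.ball x₀ r, ‖fderiv ℝ (f i) x‖ ≤ u i) (hx : x ∈ Metric.ball x₀ r) :
    fderiv ℝ (fun y => ∑' i, f i y) =ᶠ[nhds x] fun y => ∑' i, fderiv ℝ (f i) y := by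
  filter_upwards [Metric.isOpen_ball.mem_nhds hx] with y hy
  exact (hasFDerivAt_tsum_ball hu hf h0 h1 hy).fderiv

theorem hasSum_fderiv_fderiv_tsum_ball (hu : Summable u)
    (hf : ∀ i, ∀ x ∈ Metric.ball x₀ r, ContDiffAt ℝ 2 (f i) x)
    (h0 : ∀ i, ∀ x ∈ Metric.ball x₀ r, ‖f i x‖ ≤ u i)
    (h1 : ∀ i, ∀ x ∈ Metric.ball x₀ r, ‖fderiv ℝ (f i) x‖ ≤ u i)
    (h2 : ∀ i, ∀ x ∈ Metric.ball x₀ r, ‖fderiv ℝ (fderiv ℝ (f i)) x‖ ≤ u i)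
    (hx : x ∈ Metric.ball x₀ r) :
    HasSum (fun i => fderiv ℝ (fderiv ℝ (f i)) x) (fderiv ℝ (fderiv ℝ fun y => ∑' i, f i y) x) := by
  have hd : ∀ i, ∀ x ∈ Metric.ball x₀ r, DifferentiableAt ℝ (f i) x := fun i x hx =>
    (hf i x hx).differentiableAt (by norm_num)
  have hd' : ∀ i, ∀ x ∈ Metric.ball x₀ r, DifferentiableAt ℝ (fderiv ℝ (f i)) x := fun i x hx =>
    ((hf i x hx).fderiv_right (m := 1) (by norm_num)).differentiableAt (by norm_num)
  have e2 := (hasFDerivAt_tsum_ball (f := fun i => fderiv ℝ (f i)) hu hd' h1 h2 hx).fderiv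
  have e1 := (fderiv_tsum_eventuallyEq hu hd h0 h1 hx).fderiv_eq (𝕜 := ℝ)
  have hs : Summable fun i => fderiv ℝ (fderiv ℝ (f i)) x :=
    summable_fderiv_of_bound (f := fun i => fderiv ℝ (f i)) hu h2 hx
  rw [e1, e2]
  exact hs.hasSum

/-- Termwise differentiation is applied twice with the same majorant, and the series of second
derivatives is continuous by the Weierstrass test. -/
theorem contDiffOn_tsum_ball (hu : Summable u)
    (hf : ∀ i, ∀ x ∈ Metric.ball x₀ r, ContDiffAt ℝ 2 (f i) x)
    (h0 : ∀ i, ∀ x ∈ Metric.ball x₀ r, ‖f i x‖ ≤ u i)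
    (h1 : ∀ i, ∀ x ∈ Metric.ball x₀ r, ‖fderiv ℝ (f i) x‖ ≤ u i)
    (h2 : ∀ i, ∀ x ∈ Metric.ball x₀ r, ‖fderiv ℝ (fderiv ℝ (f i)) x‖ ≤ u i) :
    ContDiffOn ℝ 2 (fun y => ∑' i, f i y) (Metric.ball x₀ r) := by
  have hd : ∀ i, ∀ x ∈ Metric.ball x₀ r, DifferentiableAt ℝ (f i) x := fun i x hx =>
    (hf i x hx).differentiableAt (by norm_num)
  have hf' : ∀ i, ∀ x ∈ Metric.ball x₀ r, ContDiffAt ℝ 1 (fderiv ℝ (f i)) x := fun i x hx =>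
    (hf i x hx).fderiv_right (by norm_num)
  have hd' : ∀ i, ∀ x ∈ Metric.ball x₀ r, DifferentiableAt ℝ (fderiv ℝ (f i)) x := fun i x hx =>
    (hf' i x hx).differentiableAt (by norm_num)
  rw [show (2 : WithTop ℕ∞) = 1 + 1 by norm_num, contDiffOn_succ_iff_fderiv_of_isOpen Metric.isOpen_ball]
  refine ⟨fun x hx => (hasFDerivAt_tsum_ball hu hd h0 h1 hx).differentiableAt.differentiableWithinAt,
    by simp, ?_⟩
  have hone : ContDiffOn ℝ 1 (fun y => ∑' i, fderiv ℝ (f i) y) (Metric.ball x₀ r) := by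
    rw [show (1 : WithTop ℕ∞) = 0 + 1 by norm_num,
      contDiffOn_succ_iff_fderiv_of_isOpen Metric.isOpen_ball]
    refine ⟨fun x hx =>
      (hasFDerivAt_tsum_ball hu hd' h1 h2 hx).differentiableAt.differentiableWithinAt, by simp, ?_⟩
    rw [contDiffOn_zero]
    have hc : ContinuousOn (fun y => ∑' i, fderiv ℝ (fderiv ℝ (f i)) y) (Metric.ball x₀ r) :=
      continuousOn_tsum (fun i x hx => ((hf' i x hx).fderiv_right (m := 0)
        (by norm_num)).continuousAt.continuousWithinAt) hu h2
    exact hc.congr fun x hx => (hasFDerivAt_tsum_ball hu hd' h1 h2 hx).fderiv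
  exact hone.congr fun x hx => (hasFDerivAt_tsum_ball hu hd h0 h1 hx).fderiv

end Series

/-! ### Wirtinger derivatives in coordinates -/

/-- The Wirtinger derivative in the direction `w`, in coordinates. -/
def coordWirt (w : ℂ × ℂ × ℂ) (F : ℂ × ℂ × ℂ → ℂ) (p : ℂ × ℂ × ℂ) : ℂ :=
  (1 / 2) * (fderiv ℝ F p w - Complex.I * fderiv ℝ F p (Complex.I • w))

theorem ofCoords_add_smul (p w : ℂ × ℂ × ℂ) (t : ℝ) :
    ofCoords p + t • ofCoords w = ofCoords (p + t • w) := by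
  ext i j
  fin_cases i <;> fin_cases j <;> simp [ofCoords]

theorem smul_ofCoords (c : ℂ) (w : ℂ × ℂ × ℂ) : c • ofCoords w = ofCoords (c • w) := by
  ext i j
  fin_cases i <;> fin_cases j <;> simp [ofCoords]

/-- Only lines inside the symmetric matrices are involved, so `G` need not be regular on the full
matrix space. -/
theorem lineDeriv_ofCoords (G : Mat2 → ℂ) (p w : ℂ × ℂ × ℂ) :
    lineDeriv ℝ G (ofCoords p) (ofCoords w) = lineDeriv ℝ (fun q => G (ofCoords q)) p w := by
  simp only [lineDeriv, ofCoords_add_smul]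

theorem wirtinger_ofCoords {G : Mat2 → ℂ} {F : ℂ × ℂ × ℂ → ℂ} {p : ℂ × ℂ × ℂ}
    (hGF : (fun q => G (ofCoords q)) =ᶠ[nhds p] F) (hF : DifferentiableAt ℝ F p) (w : ℂ × ℂ × ℂ) :
    wirtinger (ofCoords w) G (ofCoords p) = coordWirt w F p := by
  rw [wirtinger, coordWirt, smul_ofCoords, lineDeriv_ofCoords, lineDeriv_ofCoords,
    hGF.lineDeriv_eq, hGF.lineDeriv_eq, hF.lineDeriv_eq_fderiv, hF.lineDeriv_eq_fderiv]

theorem hasFDerivAt_coordWirt {F : ℂ × ℂ × ℂ → ℂ} {p : ℂ × ℂ × ℂ} (hF : ContDiffAt ℝ 2 F p)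
    (w : ℂ × ℂ × ℂ) :
    DifferentiableAt ℝ (coordWirt w F) p ∧
    ∀ h, fderiv ℝ (coordWirt w F) p h = (1 / 2) * (fderiv ℝ (fderiv ℝ F) p h w
      - Complex.I * fderiv ℝ (fderiv ℝ F) p h (Complex.I • w)) := by
  have hd : HasFDerivAt (fderiv ℝ F) (fderiv ℝ (fderiv ℝ F) p) p :=
    ((hF.fderiv_right (m := 1) (by norm_num)).differentiableAt (by norm_num)).hasFDerivAt
  have h1 := hd.clm_apply (hasFDerivAt_const w p)
  have h2 := hd.clm_apply (hasFDerivAt_const (Complex.I • w) p)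
  have h3 := (h1.sub (h2.const_mul Complex.I)).const_mul (1 / 2)
  refine ⟨h3.differentiableAt, fun h => ?_⟩
  have e : fderiv ℝ (coordWirt w F) p = _ := h3.fderiv
  rw [e]
  simp

theorem coordWirt_coordWirt {F : ℂ × ℂ × ℂ → ℂ} {p : ℂ × ℂ × ℂ} (hF : ContDiffAt ℝ 2 F p)
    (w' w : ℂ × ℂ × ℂ) :
    coordWirt w' (coordWirt w F) p =
      (1 / 4) * (fderiv ℝ (fderiv ℝ F) p w' w
        - Complex.I * fderiv ℝ (fderiv ℝ F) p w' (Complex.I • w)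
        - Complex.I * (fderiv ℝ (fderiv ℝ F) p (Complex.I • w') w
        - Complex.I * fderiv ℝ (fderiv ℝ F) p (Complex.I • w') (Complex.I • w))) := by
  rw [coordWirt, (hasFDerivAt_coordWirt hF w).2, (hasFDerivAt_coordWirt hF w).2]
  ring

theorem wirtinger_wirtinger_ofCoords {G : Mat2 → ℂ} {F : ℂ × ℂ × ℂ → ℂ} {p : ℂ × ℂ × ℂ}
    (hGF : (fun q => G (ofCoords q)) =ᶠ[nhds p] F) (hF : ContDiffAt ℝ 2 F p) (w' w : ℂ × ℂ × ℂ) :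
    wirtinger (ofCoords w') (wirtinger (ofCoords w) G) (ofCoords p)
      = coordWirt w' (coordWirt w F) p := by
  refine wirtinger_ofCoords ?_ (hasFDerivAt_coordWirt hF w).1 w'
  filter_upwards [hGF.eventuallyEq_nhds, hF.eventually (by simp)] with q hq hq'
  exact wirtinger_ofCoords hq (hq'.differentiableAt (by norm_num)) w

theorem hasSum_coordWirt_coordWirt {ι : Type*} {f : ι → ℂ × ℂ × ℂ → ℂ} {F : ℂ × ℂ × ℂ → ℂ}
    {p : ℂ × ℂ × ℂ} (hf : ∀ i, ContDiffAt ℝ 2 (f i) p) (hF : ContDiffAt ℝ 2 F p)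
    (h : HasSum (fun i => fderiv ℝ (fderiv ℝ (f i)) p) (fderiv ℝ (fderiv ℝ F) p))
    (w' w : ℂ × ℂ × ℂ) :
    HasSum (fun i => coordWirt w' (coordWirt w (f i)) p) (coordWirt w' (coordWirt w F) p) := by
  have ev : ∀ a b : ℂ × ℂ × ℂ,
      HasSum (fun i => fderiv ℝ (fderiv ℝ (f i)) p a b) (fderiv ℝ (fderiv ℝ F) p a b) := fun a b =>
    (h.mapL (ContinuousLinearMap.apply ℝ (ℂ × ℂ × ℂ →L[ℝ] ℂ) a)).mapL
      (ContinuousLinearMap.apply ℝ ℂ b)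
  simp only [coordWirt_coordWirt hF, fun i => coordWirt_coordWirt (hf i)]
  exact ((((ev _ _).sub ((ev _ _).mul_left _)).sub
    (((ev _ _).sub ((ev _ _).mul_left _)).mul_left _)).mul_left _)

/-! ### Rules for Wirtinger derivatives -/

/-- `F` is real differentiable at `p` with Wirtinger derivative `a` in the direction `w`. -/
def HasWirt (w : ℂ × ℂ × ℂ) (F : ℂ × ℂ × ℂ → ℂ) (a : ℂ) (p : ℂ × ℂ × ℂ) : Prop :=
  ∃ D : ℂ × ℂ × ℂ →L[ℝ] ℂ, HasFDerivAt F D p ∧ (1 / 2) * (D w - Complex.I * D (Complex.I • w)) = a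

namespace HasWirt

variable {w : ℂ × ℂ × ℂ} {F G : ℂ × ℂ × ℂ → ℂ} {a b : ℂ} {p : ℂ × ℂ × ℂ}

theorem coordWirt_eq (h : HasWirt w F a p) : coordWirt w F p = a := by
  obtain ⟨D, hD, rfl⟩ := h
  rw [coordWirt, hD.fderiv]

theorem congr_deriv (h : HasWirt w F a p) (hab : a = b) : HasWirt w F b p := hab ▸ h

theorem const (c : ℂ) : HasWirt w (fun _ => c) 0 p := ⟨0, hasFDerivAt_const c p, by simp⟩

theorem add (hF : HasWirt w F a p) (hG : HasWirt w G b p) :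
    HasWirt w (fun q => F q + G q) (a + b) p := by
  obtain ⟨D, hD, rfl⟩ := hF
  obtain ⟨D', hD', rfl⟩ := hG
  refine ⟨D + D', hD.add hD', ?_⟩
  simp only [add_apply]
  ring

theorem mul (hF : HasWirt w F a p) (hG : HasWirt w G b p) :
    HasWirt w (fun q => F q * G q) (F p * b + a * G p) p := by
  obtain ⟨D, hD, rfl⟩ := hF
  obtain ⟨D', hD', rfl⟩ := hG
  refine ⟨_, hD.mul hD', ?_⟩
  simp only [add_apply, smul_apply, smul_eq_mul]
  ring

theorem const_mul (c : ℂ) (hF : HasWirt w F a p) : HasWirt w (fun q => c * F q) (c * a) p :=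
  ((const c).mul hF).congr_deriv (by ring)

theorem sub (hF : HasWirt w F a p) (hG : HasWirt w G b p) :
    HasWirt w (fun q => F q - G q) (a - b) p := by
  obtain ⟨D, hD, rfl⟩ := hF
  obtain ⟨D', hD', rfl⟩ := hG
  refine ⟨D - D', hD.sub hD', ?_⟩
  simp only [sub_apply]
  ring

theorem div (hF : HasWirt w F a p) (hG : HasWirt w G b p) (h0 : G p ≠ 0) :
    HasWirt w (fun q => F q / G q) (a / G p - F p * b / G p ^ 2) p := by
  have hinv : HasWirt w (fun q => (G q)⁻¹) (-b / G p ^ 2) p := by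
    obtain ⟨D', hD', rfl⟩ := hG
    refine ⟨_, (((hasDerivAt_inv h0).hasFDerivAt.restrictScalars ℝ).comp p hD'), ?_⟩
    simp
    ring
  simp only [div_eq_mul_inv]
  exact (hF.mul hinv).congr_deriv (by rw [div_eq_mul_inv]; ring)

theorem of_hasFDerivAt {D : ℂ × ℂ × ℂ →L[ℂ] ℂ} (h : HasFDerivAt F D p) : HasWirt w F (D w) p := by
  refine ⟨_, h.restrictScalars ℝ, ?_⟩
  simp only [ContinuousLinearMap.coe_restrictScalars', map_smul, smul_eq_mul]
  linear_combination (-1 / 2 * D w) * Complex.I_sq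

theorem conj_of_differentiableAt (h : DifferentiableAt ℂ F p) :
    HasWirt w (fun q => conj (F q)) 0 p := by
  refine ⟨_, (Complex.conjCLE.toContinuousLinearMap.hasFDerivAt (x := F p)).comp p
    (h.hasFDerivAt.restrictScalars ℝ), ?_⟩
  simp
  linear_combination conj (fderiv ℂ F p w) * Complex.I_sq

theorem ofReal_rpow {g : ℂ × ℂ × ℂ → ℝ} (hg : HasWirt w (fun q => (g q : ℂ)) a p) (h0 : 0 < g p)
    (s : ℝ) :
    HasWirt w (fun q => ((g q ^ s : ℝ) : ℂ)) (s * ((g p ^ s : ℝ) : ℂ) * a / g p) p := by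
  obtain ⟨D, hD, rfl⟩ := hg
  have hgD : HasFDerivAt g (Complex.reCLM.comp D) p := by
    have := (Complex.reCLM.hasFDerivAt (x := (g p : ℂ))).comp p hD
    simpa [Function.comp_def] using this
  -- Uniqueness of the derivative forces `D` to take real values.
  have hDre : ∀ h, D h = ((D h).re : ℂ) := by
    have h2 : HasFDerivAt (fun q => (g q : ℂ)) (Complex.ofRealCLM.comp (Complex.reCLM.comp D)) p :=
      (Complex.ofRealCLM.hasFDerivAt (x := g p)).comp p hgD
    intro h
    conv_lhs => rw [hD.unique h2]
    simp
  refine ⟨_, (Complex.ofRealCLM.hasFDerivAt (x := g p ^ s)).comp p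
    (hgD.rpow_const (p := s) (Or.inl h0.ne')), ?_⟩
  have e : g p ^ (s - 1) = g p ^ s / g p := by rw [Real.rpow_sub h0, Real.rpow_one]
  have hy : (g p : ℂ) ≠ 0 := by exact_mod_cast h0.ne'
  simp only [ContinuousLinearMap.comp_apply, smul_apply, Complex.ofRealCLM_apply,
    Complex.reCLM_apply, smul_eq_mul, e]
  push_cast
  rw [← hDre, ← hDre]
  field_simp

theorem congr_of_eventuallyEq (h : HasWirt w F a p) (hGF : G =ᶠ[nhds p] F) : HasWirt w G a p := by
  obtain ⟨D, hD, rfl⟩ := h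
  exact ⟨D, hD.congr_of_eventuallyEq hGF, rfl⟩

theorem fst : HasWirt w (fun q => q.1) w.1 p := of_hasFDerivAt hasFDerivAt_fst

theorem snd_fst : HasWirt w (fun q => q.2.1) w.2.1 p :=
  of_hasFDerivAt (hasFDerivAt_fst.comp p hasFDerivAt_snd)

theorem snd_snd : HasWirt w (fun q => q.2.2) w.2.2 p :=
  of_hasFDerivAt (hasFDerivAt_snd.comp p hasFDerivAt_snd)

theorem conj_fst : HasWirt w (fun q => conj q.1) 0 p :=
  conj_of_differentiableAt differentiableAt_fst

theorem conj_snd_fst : HasWirt w (fun q => conj q.2.1) 0 p :=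
  conj_of_differentiableAt (by fun_prop)

theorem conj_snd_snd : HasWirt w (fun q => conj q.2.2) 0 p :=
  conj_of_differentiableAt (by fun_prop)

end HasWirt

/-! ### Wirtinger derivatives of the general term -/

/-- The derivative of `quadJ v` at `p` in the direction `w`. -/
def quadJDeriv (v : Fin 5 → ℝ) (w p : ℂ × ℂ × ℂ) : ℂ :=
  v 0 * (p.1 * w.2.2 + w.1 * p.2.2 - 2 * (w.2.1 * p.2.1)) + v 1 * w.1 + 2 * v 2 * w.2.1 + v 3 * w.2.2

/-- The polar form of the determinant on symmetric matrices. -/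
def polarDet (w w' : ℂ × ℂ × ℂ) : ℂ := w'.1 * w.2.2 + w.1 * w'.2.2 - 2 * (w.2.1 * w'.2.1)

/-- The Wirtinger derivative of `det Y` in the direction `w`. -/
def detImDeriv (w p : ℂ × ℂ × ℂ) : ℂ :=
  -(1 / 4) * ((p.1 - conj p.1) * w.2.2 + w.1 * (p.2.2 - conj p.2.2) - 2 * (w.2.1 * (p.2.1 - conj p.2.1)))

theorem hasWirt_quadJ (v : Fin 5 → ℝ) (w p : ℂ × ℂ × ℂ) :
    HasWirt w (quadJ v) (quadJDeriv v w p) p := by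
  have h := (((((HasWirt.fst (w := w) (p := p)).mul HasWirt.snd_snd).sub
    (HasWirt.snd_fst.mul HasWirt.snd_fst)).const_mul (v 0)).add
    (HasWirt.fst.const_mul (v 1))).add (HasWirt.snd_fst.const_mul (2 * v 2)) |>.add
    (HasWirt.snd_snd.const_mul (v 3)) |>.add (HasWirt.const (v 4 : ℂ))
  refine (h.congr_deriv ?_).congr_of_eventuallyEq (Filter.Eventually.of_forall fun q => ?_)
  · simp only [quadJDeriv]
    ring
  · simp only [quadJ]
    ring

theorem hasWirt_quadJDeriv (v : Fin 5 → ℝ) (w w' p : ℂ × ℂ × ℂ) :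
    HasWirt w' (quadJDeriv v w) (v 0 * polarDet w w') p := by
  have h := ((((HasWirt.fst (w := w') (p := p)).const_mul w.2.2).add
    (HasWirt.snd_snd.const_mul w.1)).sub (HasWirt.snd_fst.const_mul (2 * w.2.1))).const_mul (v 0) |>.add
    (HasWirt.const (v 1 * w.1 + 2 * v 2 * w.2.1 + v 3 * w.2.2 : ℂ))
  refine (h.congr_deriv ?_).congr_of_eventuallyEq (Filter.Eventually.of_forall fun q => ?_)
  · simp only [polarDet]
    ring
  · simp only [quadJDeriv]
    ring

theorem coordDetIm_eq (p : ℂ × ℂ × ℂ) :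
    (coordDetIm p : ℂ) = -(1 / 4) * ((p.1 - conj p.1) * (p.2.2 - conj p.2.2)
      - (p.2.1 - conj p.2.1) * (p.2.1 - conj p.2.1)) := by
  simp only [Complex.sub_conj, coordDetIm]
  push_cast
  linear_combination (p.1.im * p.2.2.im - p.2.1.im ^ 2 : ℂ) * Complex.I_sq

theorem hasWirt_coordDetIm (w p : ℂ × ℂ × ℂ) :
    HasWirt w (fun q => (coordDetIm q : ℂ)) (detImDeriv w p) p := by
  have h1 := (HasWirt.fst (w := w) (p := p)).sub HasWirt.conj_fst
  have h2 := (HasWirt.snd_fst (w := w) (p := p)).sub HasWirt.conj_snd_fst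
  have h3 := (HasWirt.snd_snd (w := w) (p := p)).sub HasWirt.conj_snd_snd
  have h := ((h1.mul h3).sub (h2.mul h2)).const_mul (-(1 / 4))
  refine (h.congr_deriv ?_).congr_of_eventuallyEq (Filter.Eventually.of_forall fun q => ?_)
  · simp only [detImDeriv]
    ring
  · exact coordDetIm_eq q

theorem hasWirt_detImDeriv (w w' p : ℂ × ℂ × ℂ) :
    HasWirt w' (detImDeriv w) (-(1 / 4) * polarDet w w') p := by
  have h1 := (HasWirt.fst (w := w') (p := p)).sub HasWirt.conj_fst
  have h2 := (HasWirt.snd_fst (w := w') (p := p)).sub HasWirt.conj_snd_fst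
  have h3 := (HasWirt.snd_snd (w := w') (p := p)).sub HasWirt.conj_snd_snd
  have h := (((h1.const_mul w.2.2).add (h3.const_mul w.1)).sub (h2.const_mul (2 * w.2.1))).const_mul
    (-(1 / 4))
  refine (h.congr_deriv ?_).congr_of_eventuallyEq (Filter.Eventually.of_forall fun q => ?_)
  · simp only [polarDet]
    ring
  · simp only [detImDeriv]
    ring

theorem differentiable_quadJ (v : Fin 5 → ℝ) : Differentiable ℂ (quadJ v) := by
  unfold quadJ
  fun_prop

/-- The logarithmic Wirtinger derivative of the general term. -/
def logWirt (s : ℝ) (v : Fin 5 → ℝ) (w p : ℂ × ℂ × ℂ) : ℂ :=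
  s * (detImDeriv w p / coordDetIm p) + -(s + 1 / 2) * (quadJDeriv v w p / quadJ v p)

/-- Writing |J|^{-1-2s} = (J conj J)^{-1/2-s}, the Wirtinger derivative sees only J and det Y, since
conj J is antiholomorphic. -/
theorem hasWirt_isoTerm (s : ℝ) (k : ℤ) {v : Fin 5 → ℝ} {p : ℂ × ℂ × ℂ} (hJ : quadJ v p ≠ 0)
    (hy : 0 < coordDetIm p) (w : ℂ × ℂ × ℂ) :
    HasWirt w (isoTerm s k v) (isoTerm s k v p * logWirt s v w p) p := by
  have hyC : (coordDetIm p : ℂ) ≠ 0 := by exact_mod_cast hy.ne'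
  have hJc : conj (quadJ v p) ≠ 0 := by simpa using hJ
  have h1 := (hasWirt_coordDetIm w p).ofReal_rpow hy s
  have hN : ∀ q, ((‖quadJ v q‖ ^ 2 : ℝ) : ℂ) = quadJ v q * conj (quadJ v q) := fun q => by
    rw [Complex.mul_conj, Complex.normSq_eq_norm_sq]
  have h2 : HasWirt w (fun q => ((‖quadJ v q‖ ^ 2 : ℝ) : ℂ))
      (quadJDeriv v w p * conj (quadJ v p)) p := by
    refine (((hasWirt_quadJ v w p).mul
      (HasWirt.conj_of_differentiableAt (differentiable_quadJ v p))).congr_deriv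
        (by ring)).congr_of_eventuallyEq (Filter.Eventually.of_forall hN)
  have hNpos : 0 < ‖quadJ v p‖ ^ 2 := by positivity
  have h3 := h2.ofReal_rpow hNpos (-(1 / 2) - s)
  have hpow : ∀ q, (‖quadJ v q‖ ^ 2) ^ (-(1 / 2) - s) = ‖quadJ v q‖ ^ (-1 - 2 * s) := fun q => by
    rw [← Real.rpow_natCast, ← Real.rpow_mul (norm_nonneg _)]
    congr 1
    push_cast
    ring
  have h4 : HasWirt w (fun q => conj (quadJ v q) ^ (1 - k)) 0 p := by
    have : DifferentiableAt ℂ (fun q => quadJ v q ^ (1 - k)) p :=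
      (differentiable_quadJ v p).zpow (Or.inl hJ)
    simpa only [map_zpow₀] using HasWirt.conj_of_differentiableAt (w := w) this
  simp only [hpow] at h3
  refine ((h1.mul h3).mul h4).congr_deriv ?_
  rw [hN, isoTerm, logWirt]
  push_cast
  field_simp
  ring

theorem hasWirt_logWirt (s : ℝ) {v : Fin 5 → ℝ} {p : ℂ × ℂ × ℂ} (hJ : quadJ v p ≠ 0)
    (hy : 0 < coordDetIm p) (w w' : ℂ × ℂ × ℂ) :
    HasWirt w' (logWirt s v w)
      (s * (-(1 / 4) * polarDet w w' / coordDetIm p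
          - detImDeriv w p * detImDeriv w' p / coordDetIm p ^ 2)
        + -(s + 1 / 2) * (v 0 * polarDet w w' / quadJ v p
          - quadJDeriv v w p * quadJDeriv v w' p / quadJ v p ^ 2)) p := by
  have hyC : (coordDetIm p : ℂ) ≠ 0 := by exact_mod_cast hy.ne'
  exact (((hasWirt_detImDeriv w w' p).div (hasWirt_coordDetIm w' p) hyC).const_mul s).add
    (((hasWirt_quadJDeriv v w w' p).div (hasWirt_quadJ v w' p) hJ).const_mul (-(s + 1 / 2)))

theorem coordWirt_coordWirt_isoTerm (s : ℝ) (k : ℤ) {v : Fin 5 → ℝ} {p : ℂ × ℂ × ℂ}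
    (hJ : quadJ v p ≠ 0) (hy : 0 < coordDetIm p) (w' w : ℂ × ℂ × ℂ) :
    coordWirt w' (coordWirt w (isoTerm s k v)) p =
      isoTerm s k v p * (logWirt s v w p * logWirt s v w' p +
        (s * (-(1 / 4) * polarDet w w' / coordDetIm p
          - detImDeriv w p * detImDeriv w' p / coordDetIm p ^ 2)
        + -(s + 1 / 2) * (v 0 * polarDet w w' / quadJ v p
          - quadJDeriv v w p * quadJDeriv v w' p / quadJ v p ^ 2))) := by
  have hev : coordWirt w (isoTerm s k v) =ᶠ[nhds p] fun q => isoTerm s k v q * logWirt s v w q := by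
    have c1 : ∀ᶠ q in nhds p, quadJ v q ≠ 0 :=
      (differentiable_quadJ v).continuous.continuousAt.eventually_ne hJ
    have c2 : ∀ᶠ q in nhds p, 0 < coordDetIm q :=
      continuous_coordDetIm.continuousAt.eventually (lt_mem_nhds hy)
    filter_upwards [c1, c2] with q hq1 hq2
    exact (hasWirt_isoTerm s k hq1 hq2 w).coordWirt_eq
  rw [(((hasWirt_isoTerm s k hJ hy w').mul
    (hasWirt_logWirt s hJ hy w w')).congr_of_eventuallyEq hev).coordWirt_eq]
  ring

/-- The operator `∂_τ ∂_τ' - ∂_z² / 4`. -/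
def coordLaplace (F : ℂ × ℂ × ℂ → ℂ) (p : ℂ × ℂ × ℂ) : ℂ :=
  coordWirt (1, 0, 0) (coordWirt (0, 0, 1) F) p
    - (1 / 4) * coordWirt (0, 1, 0) (coordWirt (0, 1, 0) F) p

/-- The second-order symbol is a quadratic form Q. With y = det Y, Q(y) = -y/4 and, by the quadric
equation, Q(J) = v₀J; the mixed value is v₀y - (J - J̄)/4. On substitution all v₀/J and 1/y terms
cancel, and only the J̄ part of the mixed value survives. -/
theorem coordLaplace_isoTerm (s : ℝ) (k : ℤ) {v : Fin 5 → ℝ} (hv : v ∈ isotropicReal)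
    {p : ℂ × ℂ × ℂ} (hp : p ∈ ofCoords ⁻¹' siegelH2) :
    -4 * (coordDetIm p : ℂ) * coordLaplace (isoTerm s k v) p =
      s * (s + 1 / 2) * (isoTerm s k v p * conj (quadJ v p) / quadJ v p) := by
  have hJ := quadJ_ne_zero hv hp
  have hy := (mem_preimage_siegelH2.1 hp).2
  have hyC : (coordDetIm p : ℂ) ≠ 0 := by exact_mod_cast hy.ne'
  have hiso : (v 2 : ℂ) ^ 2 = v 1 * v 3 - v 0 * v 4 := by exact_mod_cast hv.2
  have Qyy : detImDeriv (1, 0, 0) p * detImDeriv (0, 0, 1) p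
      - 1 / 4 * detImDeriv (0, 1, 0) p ^ 2 = -(1 / 4) * coordDetIm p := by
    rw [coordDetIm_eq]
    simp only [detImDeriv]
    ring
  have QJJ : quadJDeriv v (1, 0, 0) p * quadJDeriv v (0, 0, 1) p
      - 1 / 4 * quadJDeriv v (0, 1, 0) p ^ 2 = v 0 * quadJ v p := by
    simp only [quadJDeriv, quadJ]
    linear_combination -hiso
  have QyJ : detImDeriv (1, 0, 0) p * quadJDeriv v (0, 0, 1) p
      + detImDeriv (0, 0, 1) p * quadJDeriv v (1, 0, 0) p
      - 1 / 2 * (detImDeriv (0, 1, 0) p * quadJDeriv v (0, 1, 0) p)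
      = v 0 * coordDetIm p - (quadJ v p - conj (quadJ v p)) / 4 := by
    rw [coordDetIm_eq]
    simp only [detImDeriv, quadJDeriv, quadJ, map_add, map_mul, map_sub, map_pow,
      Complex.conj_ofReal, map_ofNat]
    ring
  have hp13 : polarDet (0, 0, 1) (1, 0, 0) = 1 := by simp [polarDet]
  have hp22 : polarDet (0, 1, 0) (0, 1, 0) = -2 := by simp [polarDet]
  rw [coordLaplace, coordWirt_coordWirt_isoTerm s k hJ hy, coordWirt_coordWirt_isoTerm s k hJ hy,
    hp13, hp22]
  simp only [logWirt]
  generalize isoTerm s k v p = T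
  generalize (coordDetIm p : ℂ) = y at *
  generalize conj (quadJ v p) = Jb at *
  generalize quadJ v p = J at *
  generalize detImDeriv (1, 0, 0) p = y1, detImDeriv (0, 1, 0) p = y2,
    detImDeriv (0, 0, 1) p = y3, quadJDeriv v (1, 0, 0) p = J1, quadJDeriv v (0, 1, 0) p = J2,
    quadJDeriv v (0, 0, 1) p = J3 at *
  generalize (s : ℂ) = s
  generalize (v 0 : ℂ) = c at *
  -- The expression is regrouped so that first derivatives occur only through Q and its
  -- polarisation.
  trans -4 * y * (T * ((s ^ 2 - s) * (y1 * y3 - 1 / 4 * y2 ^ 2) / y ^ 2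
    - s * (s + 1 / 2) * (y1 * J3 + y3 * J1 - 1 / 2 * (y2 * J2)) / (y * J)
    + (s + 1 / 2) * (s + 3 / 2) * (J1 * J3 - 1 / 4 * J2 ^ 2) / J ^ 2
    - 3 / 8 * s / y - 3 / 2 * (s + 1 / 2) * c / J))
  · ring
  rw [Qyy, QyJ, QJJ]
  field_simp
  ring

/-! ### The series -/

/-- The vector of minors, with real entries. -/
def realMinors (M : Γ₂) : Fin 5 → ℝ := fun i => (minors M i : ℝ)

theorem realMinors_mem (M : Γ₂) : realMinors M ∈ isotropicReal := by
  refine ⟨fun h => minors_ne_zero M (funext fun i => ?_), ?_⟩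
  · exact Int.cast_eq_zero.1 (congrFun h i)
  · simp only [realMinors]
    exact_mod_cast minors_isotropic M

theorem norm_realMinors (M : Γ₂) : ‖realMinors M‖ = ‖minors M‖ := by
  have h : ∀ i, ‖realMinors M i‖₊ = ‖minors M i‖₊ := fun i => by
    ext
    simp [realMinors, Int.norm_eq_abs]
  simp only [Pi.norm_def, h]

theorem summable_norm_realMinors {κ : ℝ} (hκ : 4 ≤ κ) :
    Summable fun q : CosetSpace => ‖realMinors q.out‖ ^ (-κ) := by
  have h := (summable_isotropic_norm_rpow hκ).comp_injective minors_out_injective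
  refine h.congr fun q => ?_
  rw [norm_realMinors]
  rfl

/-- The automorphy factor contributes |J|⁻¹ conj(J)^{1-k}, and det Im(M∘Z) contributes the remaining
|J|^{-2s}. -/
theorem poincareTerm_ofCoords (k : ℤ) (s : ℝ) (M : Γ₂) {p : ℂ × ℂ × ℂ}
    (hp : p ∈ ofCoords ⁻¹' siegelH2) :
    poincareTerm k s M (ofCoords p) = isoTerm s k (realMinors M) p := by
  have hJ : detJ M (ofCoords p) = quadJ (realMinors M) p := detJ_ofCoords M p
  have hJ0 := quadJ_ne_zero (realMinors_mem M) hp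
  have hy := (mem_preimage_siegelH2.1 hp).2
  have hn : 0 < ‖quadJ (realMinors M) p‖ := norm_pos_iff.2 hJ0
  rw [poincareTerm, slash, detIm_act M (ofCoords_isSymm p) (by rwa [hJ]), hJ, detIm_ofCoords, isoTerm,
    show (k : ℂ) - 1 / 2 = 1 / 2 + ((k - 1 : ℤ) : ℂ) by push_cast; ring, powPair_eq _ _ hJ0,
    ← Complex.ofReal_cpow (by positivity), Real.div_rpow hy.le (by positivity),
    show (-(2 * (1 / 2)) : ℂ) = ((-1 : ℝ) : ℂ) by norm_num, ← Complex.ofReal_cpow hn.le,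
    show -1 - 2 * s = -1 - (2 : ℕ) * s by norm_num, Real.rpow_sub hn,
    Real.rpow_mul hn.le, Real.rpow_natCast, neg_sub]
  push_cast
  ring

theorem dirTau_eq : dirTau = ofCoords (1, 0, 0) := rfl

theorem dirZ_eq : dirZ = ofCoords (0, 1, 0) := rfl

theorem dirTau'_eq : dirTau' = ofCoords (0, 0, 1) := rfl

/-- Both lower-order coefficients contain α - 1/2. -/
theorem maassRaising_half {G : Mat2 → ℂ} {F : ℂ × ℂ × ℂ → ℂ} {p : ℂ × ℂ × ℂ}
    (hGF : (fun q => G (ofCoords q)) =ᶠ[nhds p] F) (hF : ContDiffAt ℝ 2 F p) :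
    maassRaising (1 / 2) G (ofCoords p) = -4 * (coordDetIm p : ℂ) * coordLaplace F p := by
  rw [maassRaising, dirTau_eq, dirZ_eq, dirTau'_eq, wirtinger_wirtinger_ofCoords hGF hF,
    wirtinger_wirtinger_ofCoords hGF hF, det_sub_conj, detIm_ofCoords, coordLaplace]
  ring

section

variable {k : ℤ} {s : ℝ}

theorem eventuallyEq_tsum_isoTerm (k : ℤ) (s : ℝ) {p : ℂ × ℂ × ℂ}
    (hp : p ∈ ofCoords ⁻¹' siegelH2) :
    (fun q => poincareEisenstein k s (ofCoords q)) =ᶠ[nhds p]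
      fun q => ∑' c : CosetSpace, isoTerm s k (realMinors c.out) q := by
  filter_upwards [isOpen_preimage_siegelH2.mem_nhds hp] with q hq
  exact tsum_congr fun c => poincareTerm_ofCoords k s c.out hq

theorem exists_ball_isoTerm (hκ : 4 ≤ 2 * s + k) {p : ℂ × ℂ × ℂ} (hp : p ∈ ofCoords ⁻¹' siegelH2) :
    Summable (fun c : CosetSpace => isoTerm s k (realMinors c.out) p) ∧
    ContDiffAt ℝ 2 (fun q => ∑' c : CosetSpace, isoTerm s k (realMinors c.out) q) p ∧
    HasSum (fun c : CosetSpace => fderiv ℝ (fderiv ℝ (isoTerm s k (realMinors c.out))) p)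
      (fderiv ℝ (fderiv ℝ fun q => ∑' c : CosetSpace, isoTerm s k (realMinors c.out) q) p) := by
  obtain ⟨r, hr, C, hrU, hC⟩ := exists_isoTerm_bound s k hp
  have hu := (summable_norm_realMinors hκ).mul_left C
  have hsm : ∀ c : CosetSpace, ∀ x ∈ Metric.ball p r,
      ContDiffAt ℝ 2 (isoTerm s k (realMinors c.out)) x := fun c x hx =>
    contDiffAt_isoTerm_right s k (realMinors_mem _) (hrU hx)
  have h0 := fun (c : CosetSpace) x hx => (hC _ (realMinors_mem c.out) x hx).1
  have h1 := fun (c : CosetSpace) x hx => (hC _ (realMinors_mem c.out) x hx).2.1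
  have h2 := fun (c : CosetSpace) x hx => (hC _ (realMinors_mem c.out) x hx).2.2
  have hpb : p ∈ Metric.ball p r := Metric.mem_ball_self hr
  exact ⟨Summable.of_norm_bounded hu fun c => h0 c p hpb,
    (contDiffOn_tsum_ball hu hsm h0 h1 h2).contDiffAt (Metric.isOpen_ball.mem_nhds hpb),
    hasSum_fderiv_fderiv_tsum_ball hu hsm h0 h1 h2 hpb⟩

theorem summable_poincareTerm (hκ : 4 ≤ 2 * s + k) {Z : Mat2} (hZ : Z ∈ siegelH2) :
    Summable fun q : CosetSpace => poincareTerm k s q.out Z := by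
  obtain ⟨p, rfl⟩ := exists_ofCoords_eq hZ
  simp only [poincareTerm_ofCoords k s _ hZ]
  exact (exists_ball_isoTerm hκ hZ).1

theorem contDiffOn_poincareEisenstein (hκ : 4 ≤ 2 * s + k) :
    ContDiffOn ℝ 2 (fun p => poincareEisenstein k s (ofCoords p)) (ofCoords ⁻¹' siegelH2) :=
  fun _ hp => ((exists_ball_isoTerm hκ hp).2.1.congr_of_eventuallyEq
    (eventuallyEq_tsum_isoTerm k s hp)).contDiffWithinAt

theorem maassRaising_poincareEisenstein (hκ : 4 ≤ 2 * s + k) {Z : Mat2} (hZ : Z ∈ siegelH2) :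
    maassRaising (1 / 2) (poincareEisenstein k s) Z = s * (s + 1 / 2) *
      ∑' q : CosetSpace, poincareTerm k s q.out Z * conj (detJ q.out Z) / detJ q.out Z := by
  obtain ⟨p, rfl⟩ := exists_ofCoords_eq hZ
  obtain ⟨-, hF, hD⟩ := exists_ball_isoTerm hκ hZ
  have hf : ∀ c : CosetSpace, ContDiffAt ℝ 2 (isoTerm s k (realMinors c.out)) p := fun c =>
    contDiffAt_isoTerm_right s k (realMinors_mem _) hZ
  have hL := ((hasSum_coordWirt_coordWirt hf hF hD (1, 0, 0) (0, 0, 1)).sub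
    ((hasSum_coordWirt_coordWirt hf hF hD (0, 1, 0) (0, 1, 0)).mul_left (1 / 4))).mul_left
      (-4 * (coordDetIm p : ℂ))
  rw [maassRaising_half (eventuallyEq_tsum_isoTerm k s hZ) hF, coordLaplace, ← hL.tsum_eq,
    ← tsum_mul_left]
  refine tsum_congr fun c => ?_
  have hJ : detJ c.out (ofCoords p) = quadJ (realMinors c.out) p := detJ_ofCoords c.out p
  rw [poincareTerm_ofCoords k s _ hZ, hJ, ← coordLaplace_isoTerm s k (realMinors_mem _) hZ,
    coordLaplace]

end

/-! ### Comparison with the Eisenstein series -/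

/-- Here |J|^{-1-2s} = (J J̄)^{k-2}, so the exponents of J̄ add up to (k-2) + (1-k) + 1 = 0, while J
keeps (k-2) - 1. -/
theorem poincareTerm_mul_conj_div (k : ℤ) (M : Γ₂) {Z : Mat2} (hZ : Z ∈ siegelH2) :
    ((detIm Z ^ ((k : ℝ) - 3 / 2) : ℝ) : ℂ) *
      (poincareTerm k ((3 / 2 - k : ℝ) : ℂ) M Z * conj (detJ M Z) / detJ M Z)
      = detJ M Z ^ (-(3 - k)) := by
  obtain ⟨p, rfl⟩ := exists_ofCoords_eq hZ
  have hJ : detJ M (ofCoords p) = quadJ (realMinors M) p := detJ_ofCoords M p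
  have hJ0 := quadJ_ne_zero (realMinors_mem M) hZ
  have hy := (mem_preimage_siegelH2.1 hZ).2
  rw [poincareTerm_ofCoords k _ M hZ, hJ, detIm_ofCoords, isoTerm]
  have e1 : coordDetIm p ^ ((k : ℝ) - 3 / 2) * coordDetIm p ^ (3 / 2 - (k : ℝ)) = 1 := by
    rw [← Real.rpow_add hy]
    simp
  generalize quadJ (realMinors M) p = J at *
  have hJc : conj J ≠ 0 := by simpa using hJ0
  have e2 : ((‖J‖ ^ (-1 - 2 * (3 / 2 - (k : ℝ))) : ℝ) : ℂ) = (J * conj J) ^ (k - 2) := by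
    rw [Complex.mul_conj, Complex.normSq_eq_norm_sq, ← Complex.ofReal_zpow, ← zpow_natCast, ← zpow_mul,
      ← Real.rpow_intCast]
    congr 2
    push_cast
    ring
  have e1' := congrArg (Complex.ofReal) e1
  push_cast at e1'
  rw [e2, mul_zpow, show -(3 - k) = (k - 2) - 1 by ring, zpow_sub_one₀ hJ0,
    show 1 - k = -(k - 2) - 1 by ring, zpow_sub_one₀ hJc, zpow_neg]
  have hz : conj J ^ (k - 2) ≠ 0 := zpow_ne_zero _ hJc
  calc _ = (((coordDetIm p ^ ((k : ℝ) - 3 / 2) : ℝ) : ℂ) * ((coordDetIm p ^ (3 / 2 - (k : ℝ)) : ℝ) : ℂ))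
        * (J ^ (k - 2) * J⁻¹) * (conj J ^ (k - 2) * (conj J ^ (k - 2))⁻¹) * (conj J * (conj J)⁻¹) := by
        ring
    _ = _ := by rw [e1', mul_inv_cancel₀ hz, mul_inv_cancel₀ hJc]; ring

/-- Since |J̄/J| ≤ 1, the Eisenstein terms are dominated, for fixed Z, by those of P_{k,3/2-k}. -/
theorem summable_detJ_zpow {k : ℤ} (hk : k < 0) {Z : Mat2} (hZ : Z ∈ siegelH2) :
    Summable fun q : CosetSpace => detJ q.out Z ^ (-(3 - k)) := by
  have hκ : (4 : ℝ) ≤ 2 * (3 / 2 - (k : ℝ)) + k := by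
    have : (k : ℝ) ≤ -1 := by exact_mod_cast Int.le_sub_one_of_lt hk
    linarith
  simp only [← poincareTerm_mul_conj_div k _ hZ]
  refine Summable.mul_left _ (Summable.of_norm_bounded (summable_poincareTerm hκ hZ).norm fun q => ?_)
  rw [norm_div, norm_mul, Complex.norm_conj, mul_div_assoc]
  exact mul_le_of_le_one_right (norm_nonneg _) (div_self_le_one _)

end

end SiegelMaass

theorem mainTheorem5 (k : ℤ) (hk : Odd k) :
    (3 < k →
      (∀ Z ∈ siegelH2, Summable fun q : CosetSpace => poincareTerm k 0 q.out Z) ∧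
      ContDiffOn ℝ 2 (fun p => poincareEisenstein k 0 (ofCoords p)) (ofCoords ⁻¹' siegelH2) ∧
      ∀ Z ∈ siegelH2, xiOp k (poincareEisenstein k 0) Z = 0) ∧
    (k < 0 →
      (∀ Z ∈ siegelH2, Summable fun q : CosetSpace => poincareTerm k (3 / 2 - k) q.out Z) ∧
      (∀ Z ∈ siegelH2, Summable fun q : CosetSpace => detJ q.out Z ^ (-(3 - k))) ∧
      ContDiffOn ℝ 2 (fun p => poincareEisenstein k (3 / 2 - k) (ofCoords p))
        (ofCoords ⁻¹' siegelH2) ∧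
      ∀ Z ∈ siegelH2,
        xiOp k (poincareEisenstein k (3 / 2 - k)) Z =
          ((k : ℂ) - 3 / 2) * ((k : ℂ) - 2) * siegelEisenstein (3 - k) Z) := by
  constructor
  · intro h3
    have hκ : (4 : ℝ) ≤ 2 * 0 + k := by
      have : (4 : ℝ) ≤ k := by exact_mod_cast h3
      linarith
    have h0 : (0 : ℂ) = ((0 : ℝ) : ℂ) := Complex.ofReal_zero.symm
    rw [h0]
    refine ⟨fun Z hZ => summable_poincareTerm hκ hZ, contDiffOn_poincareEisenstein hκ,
      fun Z hZ => ?_⟩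
    rw [xiOp, maassRaising_poincareEisenstein hκ hZ]
    simp
  · intro h0
    -- The decay exponent 2s + k equals the weight 3 - k, and k ≤ -1.
    have hκ : (4 : ℝ) ≤ 2 * (3 / 2 - (k : ℝ)) + k := by
      have : (k : ℝ) ≤ -1 := by exact_mod_cast Int.le_sub_one_of_lt h0
      linarith
    have hs : (3 / 2 - k : ℂ) = ((3 / 2 - k : ℝ) : ℂ) := by push_cast; ring
    rw [hs]
    refine ⟨fun Z hZ => summable_poincareTerm hκ hZ, fun Z hZ => summable_detJ_zpow h0 hZ,
      contDiffOn_poincareEisenstein hκ, fun Z hZ => ?_⟩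
    rw [xiOp, maassRaising_poincareEisenstein hκ hZ, siegelEisenstein, mul_left_comm, ← tsum_mul_left]
    congr 1
    -- s(s + 1/2) = (3/2 - k)(2 - k); the two signs cancel.
    · push_cast
      ring
    · exact tsum_congr fun q => poincareTerm_mul_conj_div k q.out hZ
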